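/- Let $(\Omega,\mathcal F,(\mathcal F_t)_{t\ge 0},\mathbb P)$ be a filtered probability space satisfying the usual conditions, let $H$ be a separable (real) Hilbert space and let $T>0$. Let $M$ be a real-valued Lévy process with respect to $(\mathcal F_t)$ (adapted, càdlàg, $M_0=0$ a.s., with stationary increments $M_t-M_s$ that are independent of $\mathcal F_s$ for $s\le t$) which is a martingale and satisfies $\mathbb E[M_1^2]<\infty$. Let $\Phi:[0,T]\to L^2(\Omega;H)$ be continuous and adapted, that is, $\Phi_t$ is $\mathcal F_t$-measurable for every $t$. Then for every $t\in[0,T]$ there is a unique $I_t(\Phi)\in L^2(\Omega;H)$, the van Gaans integral $I_t(\Phi)=\text{(G-)}\int_0^t\Phi_s\,dM_s$, such that for every $\varepsilon>0$ there is $\delta>0$ with $$\mathbb E\Big[\Big\|I_t(\Phi)-\sum_{i=0}^{n-1}(M_{t_{i+1}}-M_{t_i})\Phi_{t_i}\Big\|^2\Big]<\varepsilon$$ for every partition $0=t_0<t_1<\dots<t_n=t$ with $\max_i|t_{i+1}-t_i|<\delta$. Let $\mathcal M^2$ be the space of all $H$-valued càdlàg martingales $X=(X_t)_{t\in[0,T]}$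 with $\mathbb E[\|X_t\|^2]<\infty$ for all $t\in[0,T]$, with the norm $\|X\|_2=\mathbb E\big[\sup_{t\in[0,T]}\|X_t\|^2\big]^{1/2}$, and for $n\in\mathbb N_0$ and $t\in[0,T]$ let $$I^n_t(\Phi)=\sum_{i=0}^{2^n-1}\big(M_{t\wedge t^n_{i+1}}-M_{t\wedge t^n_i}\big)\Phi_{t^n_i},\qquad t^n_i=i\,2^{-n}T .$$ Then every $I^n(\Phi)$ belongs to $\mathcal M^2$ and has finite norm, and the process $I(\Phi)=(I_t(\Phi))_{t\in[0,T]}$ has a modification $\tilde I$ (that is, $\mathbb P(\tilde I_t=I_t(\Phi))=1$ for all $t\in[0,T]$) which belongs to $\mathcal M^2$, has finite norm, and satisfies $\|I^n(\Phi)-\tilde I\|_2\to 0$ as $n\to\infty$. -/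

import Mathlib

open MeasureTheory ProbabilityTheory Filter Topology
open scoped NNReal ENNReal

noncomputable section

namespace VanGaans

section General

/-- A path is càdlàg: right-continuous with left limits at every point of its index set. -/
def IsCadlag {ι E : Type*} [TopologicalSpace ι] [Preorder ι] [TopologicalSpace E]
    (f : ι → E) : Prop :=
  ∀ t, ContinuousWithinAt f (Set.Ici t) t ∧ ∃ l, Tendsto f (𝓝[<] t) (𝓝 l)

variable {Ω : Type*} {mΩ : MeasurableSpace Ω}

/-- The usual conditions: the filtration is right-continuous, and every `P`-null set (measurable
or not, so that `P` is complete) belongs to `𝓕 0`. -/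
structure UsualConditions (𝓕 : Filtration ℝ≥0 mΩ) (P : Measure Ω) : Prop where
  rightContinuous : 𝓕.IsRightContinuous
  complete : ∀ s : Set Ω, P s = 0 → MeasurableSet[𝓕 0] s

/-- A real-valued Lévy process relative to the filtration `𝓕`: adapted, càdlàg, starting at `0`,
with increments that are stationary and independent of the past. -/
structure IsLevyProcess (𝓕 : Filtration ℝ≥0 mΩ) (P : Measure Ω) (X : ℝ≥0 → Ω → ℝ) : Prop where
  adapted : StronglyAdapted 𝓕 X
  cadlag : ∀ ω, IsCadlag (fun t => X t ω)
  start : ∀ᵐ ω ∂P, X 0 ω = 0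
  indep : ∀ s t, s ≤ t →
    Indep (MeasurableSpace.comap (fun ω => X t ω - X s ω) inferInstance) (𝓕 s) P
  stationary : ∀ s h, IdentDistrib (fun ω => X (s + h) ω - X s ω) (X h) P P

/-- A real-valued Lévy process which is a martingale. -/
structure IsLevyMartingale (𝓕 : Filtration ℝ≥0 mΩ) (P : Measure Ω) (M : ℝ≥0 → Ω → ℝ) : Prop where
  levy : IsLevyProcess 𝓕 P M
  martingale : Martingale M 𝓕 P

/-- The filtration `(𝓕 t)` for `t ∈ [0,T]`. -/
def restrictIcc (𝓕 : Filtration ℝ≥0 mΩ) (T : ℝ≥0) : Filtration (Set.Icc (0 : ℝ≥0) T) mΩ where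
  seq t := 𝓕 t
  mono' _ _ h := 𝓕.mono h
  le' t := 𝓕.le t

/-- `Y` is a modification of `X`. -/
def IsModification {ι E : Type*} (P : Measure Ω) (X Y : ι → Ω → E) : Prop :=
  ∀ t, ∀ᵐ ω ∂P, X t ω = Y t ω

end General

section Integral

variable {Ω : Type*} {mΩ : MeasurableSpace Ω} {P : Measure Ω} {T : ℝ≥0}
  {H : Type*} [NormedAddCommGroup H] [InnerProductSpace ℝ H]

/-- `Φ ∈ C_ad([0,T]; L²(Ω;H))`: the map `Φ : [0,T] → L²(Ω;H)` is continuous and adapted, that is,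
`Φ t` is (the class of) an `𝓕 t`-measurable random variable for every `t`. -/
structure IsCAd (𝓕 : Filtration ℝ≥0 mΩ) (Φ : Set.Icc (0 : ℝ≥0) T → Lp H 2 P) : Prop where
  continuous : Continuous Φ
  adapted : ∀ t : Set.Icc (0 : ℝ≥0) T, Φ t ∈ lpMeas H ℝ (𝓕 t) 2 P

/-- The Riemann sum `∑ i, (M (π (i+1)) - M (π i)) Φ (π i)` over the points `π 0, …, π n`. -/
def riemannSum (M : ℝ≥0 → Ω → ℝ) (Φ : Set.Icc (0 : ℝ≥0) T → Lp H 2 P) {n : ℕ}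
    (π : Fin (n + 1) → Set.Icc (0 : ℝ≥0) T) (ω : Ω) : H :=
  ∑ i : Fin n, (M (π i.succ) ω - M (π i.castSucc) ω) • Φ (π i.castSucc) ω

/-- `π` is a partition `0 = π 0 < π 1 < ⋯ < π n = t` of `[0,t]` (with `n = 0` exactly if
`t = 0`). -/
structure IsPartition {n : ℕ} (π : Fin (n + 1) → Set.Icc (0 : ℝ≥0) T)
    (t : Set.Icc (0 : ℝ≥0) T) : Prop where
  first : (π 0 : ℝ≥0) = 0
  last : π (Fin.last n) = t
  strictMono : StrictMono π

/-- `Y ∈ L²(Ω;H)` is the van Gaans integral of `Φ` with respect to `M` over `[0,t]`: the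
`L²`-limit of the Riemann sums with left end points along partitions of mesh tending to `0`. -/
def IsVanGaansIntegral (M : ℝ≥0 → Ω → ℝ) (Φ : Set.Icc (0 : ℝ≥0) T → Lp H 2 P)
    (t : Set.Icc (0 : ℝ≥0) T) (Y : Lp H 2 P) : Prop :=
  ∀ ε : ℝ, 0 < ε → ∃ δ : ℝ, 0 < δ ∧
    ∀ (n : ℕ) (π : Fin (n + 1) → Set.Icc (0 : ℝ≥0) T), IsPartition π t →
      (∀ i : Fin n, |((π i.succ : ℝ≥0) : ℝ) - ((π i.castSucc : ℝ≥0) : ℝ)| < δ) →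
      ∫⁻ ω, ‖Y ω - riemannSum M Φ π ω‖ₑ ^ 2 ∂P < ENNReal.ofReal ε

open Classical in
/-- The van Gaans integral `(G-)∫₀ᵗ Φ dM`, as an element of `L²(Ω;H)` (with the value `0` in case
no such element exists). -/
def vanGaansIntegral (M : ℝ≥0 → Ω → ℝ) (Φ : Set.Icc (0 : ℝ≥0) T → Lp H 2 P)
    (t : Set.Icc (0 : ℝ≥0) T) : Lp H 2 P :=
  if h : ∃ Y, IsVanGaansIntegral M Φ t Y then h.choose else 0

/-- The dyadic point `i 2⁻ⁿ T` of `[0,T]`, for `i = 0, …, 2ⁿ`. -/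
def dyadicPoint (T : ℝ≥0) (n : ℕ) (i : Fin (2 ^ n + 1)) : Set.Icc (0 : ℝ≥0) T :=
  ⟨((i : ℕ) : ℝ≥0) * (2 ^ n)⁻¹ * T, zero_le, by
    have h : (((i : ℕ) : ℝ≥0)) ≤ 2 ^ n := by
      exact_mod_cast Nat.lt_succ_iff.mp i.isLt
    calc ((i : ℕ) : ℝ≥0) * (2 ^ n)⁻¹ * T ≤ 2 ^ n * (2 ^ n)⁻¹ * T := by gcongr
      _ = T := by rw [mul_inv_cancel₀ (by positivity), one_mul]⟩

/-- The dyadic Riemann-sum process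
`t ↦ ∑ i < 2ⁿ, (M (t ∧ t_{i+1}) - M (t ∧ t_i)) Φ (t_i)` with `t_i = i 2⁻ⁿ T`. -/
def dyadicProcess (M : ℝ≥0 → Ω → ℝ) (Φ : Set.Icc (0 : ℝ≥0) T → Lp H 2 P) (n : ℕ)
    (t : Set.Icc (0 : ℝ≥0) T) (ω : Ω) : H :=
  ∑ i : Fin (2 ^ n),
    (M (min (t : ℝ≥0) (dyadicPoint T n i.succ)) ω
      - M (min (t : ℝ≥0) (dyadicPoint T n i.castSucc)) ω) • Φ (dyadicPoint T n i.castSucc) ω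

/-- Membership in `𝓜²`: càdlàg `H`-valued square-integrable martingales on `[0,T]`. -/
structure MemM2 [CompleteSpace H] (𝓕 : Filtration ℝ≥0 mΩ) (P : Measure Ω)
    (X : Set.Icc (0 : ℝ≥0) T → Ω → H) : Prop where
  martingale : Martingale X (restrictIcc 𝓕 T) P
  cadlag : ∀ ω, IsCadlag (fun t => X t ω)
  memLp : ∀ t, MemLp (X t) 2 P

/-- The norm `E[sup_{t ∈ [0,T]} ‖X t‖²]^{1/2}` of `𝓜²`, with values in `[0,∞]`. -/
def normM2 (P : Measure Ω) (X : Set.Icc (0 : ℝ≥0) T → Ω → H) : ℝ≥0∞ :=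
  (∫⁻ ω, ⨆ t, ‖X t ω‖ₑ ^ 2 ∂P) ^ (1 / 2 : ℝ)

end Integral

end VanGaans

end

/-!
The proof rests on one notion, a square-integrable *martingale increment* from a σ-algebra `m₀` to
a σ-algebra `m₁` (`IsMartingaleIncrement`), and on Pythagoras' theorem for sums of such increments
over successive σ-algebras (`IsMartingaleIncrement.integral_norm_sq_sum_range`).

Since `M` is a martingale, `E[(M t - M s) ^ 2] = f t - f s` with `f t = E[M t ^ 2]`, and since
`M t - M s` is independent of `𝓕 s`, `E[‖(M t - M s) • φ‖ ^ 2] = (f t - f s) E[‖φ‖ ^ 2]` for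
`𝓕 s`-measurable `φ`. That `f` is linear is not needed. With Pythagoras this yields the isometry
for step processes. Applied on an interval `[s,t]` of length at most `δ`, it shows that the
increment of a sufficiently fine dyadic process `I ^ n` differs from `(M t - M s) • Φ s` by a
martingale increment whose second moment is at most `(f t - f s) ε ^ 2`, where `ε` bounds the
oscillation of `Φ` over distances up to `δ`. Along a partition of `[0,t]` of mesh less than `δ`
these errors are orthogonal, so that `I ^ n t` differs from the Riemann sum by at most
`√(f t) ε` in `L²` (`IsLevyMartingale.eLpNorm_dyadicProcess_sub_riemannSum_le`). No common
refinement of partitions is needed. Hence `I ^ n t` is a Cauchy sequence, its limit is the van Gaans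
integral, and the integral is unique because there are arbitrarily fine partitions.

For the modification, Doob's inequality `E[sup ‖X t‖ ^ 2] ≤ 4 E[‖X T‖ ^ 2]` for càdlàg martingales
is proved from a pathwise inequality for running maxima (`partialSups_sq_add_sum_le`), and carried
over from the dyadic grids to `[0,T]` by Fatou's lemma (`MemM2.exists_measurable_majorant`). It
makes a rapidly convergent subsequence of `I ^ n` converge uniformly on `[0,T]` almost surely.
The limit is càdlàg, it is adapted because the filtration is complete, and it is a martingale because
conditional expectations are continuous in `L²` (`exists_memM2_modification`). Doob's inequality for
the difference of `I ^ n` and the limit gives the convergence in the norm of `𝓜²`.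
-/

namespace VanGaans

/-! ### Square-integrable martingale increments -/

section Increments

variable {Ω : Type*} {mΩ : MeasurableSpace Ω} {P : Measure Ω}
  {H : Type*} [NormedAddCommGroup H]

theorem lintegral_enorm_sq_eq_eLpNorm_sq (f : Ω → H) :
    ∫⁻ ω, ‖f ω‖ₑ ^ 2 ∂P = eLpNorm f 2 P ^ 2 := by
  have h := eLpNorm_nnreal_pow_eq_lintegral (f := f) (μ := P) (p := 2) two_ne_zero
  norm_num at h
  exact h.symm

theorem ofReal_integral_norm_sq {f : Ω → H} (hf : MemLp f 2 P) :
    ENNReal.ofReal (∫ ω, ‖f ω‖ ^ 2 ∂P) = ∫⁻ ω, ‖f ω‖ₑ ^ 2 ∂P := by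
  rw [ofReal_integral_eq_lintegral_ofReal (hf.integrable_norm_pow two_ne_zero)
    (ae_of_all _ fun ω => by positivity)]
  refine lintegral_congr fun ω => ?_
  rw [ENNReal.ofReal_pow (norm_nonneg _), ofReal_norm]

variable [InnerProductSpace ℝ H]

/-- The pairing of square-integrable functions is integrable. -/
theorem integrable_inner_of_memLp_two {f g : Ω → H} (hf : MemLp f 2 P) (hg : MemLp g 2 P) :
    Integrable (fun ω => inner ℝ (f ω) (g ω)) P := by
  refine Integrable.mono (hf.norm.integrable_mul hg.norm)
    (hf.aestronglyMeasurable.inner hg.aestronglyMeasurable) (ae_of_all _ fun ω => ?_)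
  simpa using norm_inner_le_norm (𝕜 := ℝ) (f ω) (g ω)

variable [CompleteSpace H]

/-- `D` is a square-integrable martingale increment from `m₀` to `m₁`: it is measurable with
respect to `m₁` (up to a null set) and its conditional expectation given `m₀` vanishes. -/
structure IsMartingaleIncrement (P : Measure Ω) (m₀ m₁ : MeasurableSpace Ω) (D : Ω → H) :
    Prop where
  memLp : MemLp D 2 P
  meas : AEStronglyMeasurable[m₁] D P
  condExp : P[D | m₀] =ᵐ[P] 0

namespace IsMartingaleIncrement

variable [IsProbabilityMeasure P] {m₀ m₁ m₂ : MeasurableSpace Ω} {D E : Ω → H}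

omit [CompleteSpace H] [IsProbabilityMeasure P] in
theorem zero : IsMartingaleIncrement P m₀ m₁ (fun _ => (0 : H)) where
  memLp := MemLp.zero
  meas := aestronglyMeasurable_const
  condExp := by
    have := condExp_zero (μ := P) (m := m₀) (E := H)
    exact Filter.EventuallyEq.of_eq this

omit [IsProbabilityMeasure P] in
theorem congr_ae (h : IsMartingaleIncrement P m₀ m₁ D) (hDE : D =ᵐ[P] E) :
    IsMartingaleIncrement P m₀ m₁ E where
  memLp := h.memLp.ae_eq hDE
  meas := h.meas.congr hDE
  condExp := (condExp_congr_ae hDE).symm.trans h.condExp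

omit [CompleteSpace H] [IsProbabilityMeasure P] in
theorem mono_right (h : IsMartingaleIncrement P m₀ m₁ D) (h₁₂ : m₁ ≤ m₂) :
    IsMartingaleIncrement P m₀ m₂ D where
  memLp := h.memLp
  meas := h.meas.mono h₁₂
  condExp := h.condExp

theorem mono_left (h : IsMartingaleIncrement P m₁ m₂ D) (h₀₁ : m₀ ≤ m₁) (h₁ : m₁ ≤ mΩ) :
    IsMartingaleIncrement P m₀ m₂ D where
  memLp := h.memLp
  meas := h.meas
  condExp := by
    have h1 : P[P[D | m₁] | m₀] =ᵐ[P] P[D | m₀] := condExp_condExp_of_le h₀₁ h₁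
    exact h1.symm.trans ((condExp_congr_ae h.condExp).trans
      (Filter.EventuallyEq.of_eq (condExp_zero (μ := P) (m := m₀) (E := H))))

theorem add (hD : IsMartingaleIncrement P m₀ m₁ D) (hE : IsMartingaleIncrement P m₀ m₁ E) :
    IsMartingaleIncrement P m₀ m₁ (fun ω => D ω + E ω) where
  memLp := hD.memLp.add hE.memLp
  meas := hD.meas.add hE.meas
  condExp := by
    refine (condExp_add (hD.memLp.integrable one_le_two) (hE.memLp.integrable one_le_two)
      m₀).trans ?_
    filter_upwards [hD.condExp, hE.condExp] with ω h1 h2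
    simp [h1, h2]

theorem sum_range {D : ℕ → Ω → H} {m : ℕ → MeasurableSpace Ω} (hm : Monotone m)
    (hmΩ : ∀ i, m i ≤ mΩ) (h : ∀ i, IsMartingaleIncrement P (m i) (m (i + 1)) (D i)) (n : ℕ) :
    IsMartingaleIncrement P (m 0) (m n) (fun ω => ∑ i ∈ Finset.range n, D i ω) := by
  induction n with
  | zero => simpa using zero
  | succ n ih =>
    simp_rw [Finset.sum_range_succ]
    exact (ih.mono_right (hm n.le_succ)).add ((h n).mono_left (hm (Nat.zero_le n)) (hmΩ n))

/-- A martingale increment is orthogonal to the square-integrable functions of the past. -/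
theorem integral_inner_eq_zero (hD : IsMartingaleIncrement P m₀ m₁ D) (hm : m₀ ≤ mΩ)
    {Z : Ω → H} (hZ : MemLp Z 2 P) (hZm : AEStronglyMeasurable[m₀] Z P) :
    ∫ ω, inner ℝ (Z ω) (D ω) ∂P = 0 := by
  have h := condExp_bilin_of_aestronglyMeasurable_left (innerSL ℝ) hZm
    (integrable_inner_of_memLp_two hZ hD.memLp) (hD.memLp.integrable one_le_two)
  have h2 : ∫ ω, (innerSL ℝ (Z ω)) (D ω) ∂P = 0 := by
    rw [← integral_condExp hm, integral_congr_ae h]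
    refine integral_eq_zero_of_ae ?_
    filter_upwards [hD.condExp] with ω hω
    simp [hω]
  simpa using h2

/-- Pythagoras' theorem for martingale increments over successive σ-algebras. -/
theorem integral_norm_sq_sum_range {D : ℕ → Ω → H} {m : ℕ → MeasurableSpace Ω} (hm : Monotone m)
    (hmΩ : ∀ i, m i ≤ mΩ) (h : ∀ i, IsMartingaleIncrement P (m i) (m (i + 1)) (D i)) (n : ℕ) :
    ∫ ω, ‖∑ i ∈ Finset.range n, D i ω‖ ^ 2 ∂P = ∑ i ∈ Finset.range n, ∫ ω, ‖D i ω‖ ^ 2 ∂P := by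
  induction n with
  | zero => simp
  | succ n ih =>
    have hS := sum_range hm hmΩ h n
    have hD := h n
    simp_rw [Finset.sum_range_succ, norm_add_sq_real]
    have i1 := hS.memLp.integrable_norm_pow two_ne_zero
    have i2 := hD.memLp.integrable_norm_pow two_ne_zero
    have i3 := (integrable_inner_of_memLp_two hS.memLp hD.memLp).const_mul 2
    have i4 : Integrable (fun ω => ‖∑ i ∈ Finset.range n, D i ω‖ ^ 2
        + 2 * inner ℝ (∑ i ∈ Finset.range n, D i ω) (D n ω)) P := i1.add i3
    rw [integral_add i4 i2, integral_add i1 i3, integral_const_mul,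
      hD.integral_inner_eq_zero (hmΩ n) hS.memLp hS.meas, ih]
    simp

end IsMartingaleIncrement

end Increments

/-! ### Square-integrable Lévy martingales -/

section Levy

variable {Ω : Type*} {mΩ : MeasurableSpace Ω} {P : Measure Ω} [IsProbabilityMeasure P]
  {𝓕 : Filtration ℝ≥0 mΩ} {M : ℝ≥0 → Ω → ℝ}
  {H : Type*} [NormedAddCommGroup H] [InnerProductSpace ℝ H] [CompleteSpace H]

omit [IsProbabilityMeasure P] in
/-- Square integrability passes from `M 1` to `M t` for `t ≤ 1` by the martingale property, and
from there to all times because increments of equal length are identically distributed. -/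
theorem IsLevyMartingale.memLp (hM : IsLevyMartingale 𝓕 P M) (hM2 : MemLp (M 1) 2 P) (t : ℝ≥0) :
    MemLp (M t) 2 P := by
  have small : ∀ h : ℝ≥0, h ≤ 1 → MemLp (M h) 2 P := fun h hh =>
    (hM2.condExp (m := 𝓕 h) one_le_two).ae_eq (hM.martingale.2 h 1 hh)
  have mult : ∀ h : ℝ≥0, h ≤ 1 → ∀ k : ℕ, MemLp (M (k * h)) 2 P := by
    intro h hh k
    induction k with
    | zero => simpa using small 0 zero_le_one
    | succ k ih =>
      have h1 := ((hM.levy.stationary (k * h) h).memLp_iff (p := 2)).2 (small h hh)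
      have h2 := ih.add h1
      have e : ((k + 1 : ℕ) : ℝ≥0) * h = k * h + h := by push_cast; ring
      rw [e]
      refine h2.ae_eq (ae_of_all _ fun ω => ?_)
      simp
  have hn : (0 : ℝ≥0) < (⌈t⌉₊ + 1 : ℕ) := by positivity
  have := mult (t / (⌈t⌉₊ + 1 : ℕ)) ?_ (⌈t⌉₊ + 1)
  · rwa [mul_div_cancel₀ _ hn.ne'] at this
  · rw [div_le_one hn]
    push_cast
    exact (Nat.le_ceil t).trans (by simp)

/-- The variance function `t ↦ E[M t ^ 2]`. -/
noncomputable def secondMoment (P : Measure Ω) (M : ℝ≥0 → Ω → ℝ) (t : ℝ≥0) : ℝ :=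
  ∫ ω, M t ω ^ 2 ∂P

omit [IsProbabilityMeasure P] in
theorem secondMoment_nonneg (t : ℝ≥0) : 0 ≤ secondMoment P M t :=
  integral_nonneg fun ω => by positivity

omit [IsProbabilityMeasure P] in
theorem IsLevyMartingale.secondMoment_zero (hM : IsLevyMartingale 𝓕 P M) :
    secondMoment P M 0 = 0 := by
  refine integral_eq_zero_of_ae ?_
  filter_upwards [hM.levy.start] with ω hω
  simp [hω]

omit [IsProbabilityMeasure P] in
theorem IsLevyMartingale.isMartingaleIncrement (hM : IsLevyMartingale 𝓕 P M)
    (hM2 : MemLp (M 1) 2 P) {s t : ℝ≥0} (hst : s ≤ t) :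
    IsMartingaleIncrement P (𝓕 s) (𝓕 t) (fun ω => M t ω - M s ω) where
  memLp := (hM.memLp hM2 t).sub (hM.memLp hM2 s)
  meas := ((hM.levy.adapted t).sub ((hM.levy.adapted s).mono (𝓕.mono hst))).aestronglyMeasurable
  condExp := by
    refine (condExp_sub (hM.martingale.integrable t) (hM.martingale.integrable s) _).trans ?_
    filter_upwards [hM.martingale.2 s t hst, hM.martingale.2 s s le_rfl] with ω h1 h2
    simp [h1, h2]

theorem IsLevyMartingale.integral_sub_sq (hM : IsLevyMartingale 𝓕 P M)
    (hM2 : MemLp (M 1) 2 P) {s t : ℝ≥0} (hst : s ≤ t) :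
    ∫ ω, (M t ω - M s ω) ^ 2 ∂P = secondMoment P M t - secondMoment P M s := by
  have hD := hM.isMartingaleIncrement hM2 hst
  have hs := hM.memLp hM2 s
  have h0 := hD.integral_inner_eq_zero (𝓕.le s) hs (hM.levy.adapted s).aestronglyMeasurable
  have e : ∀ ω, M t ω ^ 2 = M s ω ^ 2 + 2 * inner ℝ (M s ω) (M t ω - M s ω)
      + (M t ω - M s ω) ^ 2 := fun ω => by
    simp only [RCLike.inner_apply, conj_trivial]; ring
  have i2 := (integrable_inner_of_memLp_two hs hD.memLp).const_mul 2
  unfold secondMoment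
  simp_rw [e]
  have i3 : Integrable (fun ω => M s ω ^ 2 + 2 * inner ℝ (M s ω) (M t ω - M s ω)) P :=
    hs.integrable_sq.add i2
  rw [integral_add i3 hD.memLp.integrable_sq,
    integral_add hs.integrable_sq i2, integral_const_mul, h0]
  ring

theorem IsLevyMartingale.secondMoment_mono (hM : IsLevyMartingale 𝓕 P M)
    (hM2 : MemLp (M 1) 2 P) : Monotone (secondMoment P M) := fun s t hst => by
  have h := hM.integral_sub_sq hM2 hst
  have : 0 ≤ ∫ ω, (M t ω - M s ω) ^ 2 ∂P := integral_nonneg fun ω => by positivity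
  linarith

omit [IsProbabilityMeasure P] [CompleteSpace H] in
/-- Independence of `M t - M s` and `φ` makes the expectation of the product factorize. -/
theorem IsLevyMartingale.lintegral_smul_sq (hM : IsLevyMartingale 𝓕 P M)
    {s t : ℝ≥0} (hst : s ≤ t) {φ : Ω → H} (hφ : AEStronglyMeasurable[𝓕 s] φ P) :
    ∫⁻ ω, ‖(M t ω - M s ω) • φ ω‖ₑ ^ 2 ∂P
      = (∫⁻ ω, ‖M t ω - M s ω‖ₑ ^ 2 ∂P) * ∫⁻ ω, ‖φ ω‖ₑ ^ 2 ∂P := by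
  have hle : MeasurableSpace.comap (fun ω => M t ω - M s ω) inferInstance ≤ mΩ :=
    (((hM.levy.adapted t).mono (𝓕.le t)).sub
      ((hM.levy.adapted s).mono (𝓕.le s))).measurable.comap_le
  have h := lintegral_mul_eq_lintegral_mul_lintegral_of_independent_measurableSpace
    (f := fun ω => ‖M t ω - M s ω‖ₑ ^ 2) (g := fun ω => ‖hφ.mk φ ω‖ₑ ^ 2) hle (𝓕.le s)
    (hM.levy.indep s t hst)
    ((continuous_enorm.measurable.comp (comap_measurable _)).pow_const 2)
    (hφ.stronglyMeasurable_mk.enorm.pow_const 2)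
  have e : ∫⁻ ω, ‖φ ω‖ₑ ^ 2 ∂P = ∫⁻ ω, ‖hφ.mk φ ω‖ₑ ^ 2 ∂P :=
    lintegral_congr_ae (by filter_upwards [hφ.ae_eq_mk] with ω hω; rw [hω])
  rw [e, ← h]
  refine lintegral_congr_ae ?_
  filter_upwards [hφ.ae_eq_mk] with ω hω
  rw [← hω, enorm_smul, mul_pow]

theorem IsLevyMartingale.isMartingaleIncrement_smul (hM : IsLevyMartingale 𝓕 P M)
    (hM2 : MemLp (M 1) 2 P) {s t : ℝ≥0} (hst : s ≤ t) {φ : Ω → H} (hφ2 : MemLp φ 2 P)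
    (hφ : s < t → AEStronglyMeasurable[𝓕 s] φ P) :
    IsMartingaleIncrement P (𝓕 s) (𝓕 t) (fun ω => (M t ω - M s ω) • φ ω) := by
  rcases hst.eq_or_lt with rfl | hlt
  · simpa using IsMartingaleIncrement.zero
  replace hφ := hφ hlt
  have hD := hM.isMartingaleIncrement hM2 hst
  have hmeas : AEStronglyMeasurable[𝓕 t] (fun ω => (M t ω - M s ω) • φ ω) P :=
    hD.meas.smul (hφ.mono (𝓕.mono hst))
  have hmem : MemLp (fun ω => (M t ω - M s ω) • φ ω) 2 P := by
    refine ⟨hmeas.mono (𝓕.le t), ?_⟩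
    have h := hM.lintegral_smul_sq hst hφ
    rw [lintegral_enorm_sq_eq_eLpNorm_sq, lintegral_enorm_sq_eq_eLpNorm_sq,
      lintegral_enorm_sq_eq_eLpNorm_sq, ← mul_pow] at h
    have h' := (ENNReal.pow_right_strictMono two_ne_zero).injective h
    rw [h']
    exact ENNReal.mul_lt_top hD.memLp.2 hφ2.2
  refine ⟨hmem, hmeas, ?_⟩
  have := condExp_smul_of_aestronglyMeasurable_right (hD.memLp.integrable one_le_two)
    (hmem.integrable one_le_two) hφ
  refine this.trans ?_
  filter_upwards [hD.condExp] with ω hω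
  simp [hω]

theorem IsLevyMartingale.integral_norm_sq_smul (hM : IsLevyMartingale 𝓕 P M)
    (hM2 : MemLp (M 1) 2 P) {s t : ℝ≥0} (hst : s ≤ t) {φ : Ω → H} (hφ2 : MemLp φ 2 P)
    (hφ : s < t → AEStronglyMeasurable[𝓕 s] φ P) :
    ∫ ω, ‖(M t ω - M s ω) • φ ω‖ ^ 2 ∂P
      = (secondMoment P M t - secondMoment P M s) * ∫ ω, ‖φ ω‖ ^ 2 ∂P := by
  rcases hst.eq_or_lt with rfl | hlt
  · simp
  have hD := hM.isMartingaleIncrement hM2 hst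
  have h := hM.lintegral_smul_sq hst (hφ hlt)
  rw [← ofReal_integral_norm_sq (hM.isMartingaleIncrement_smul hM2 hst hφ2 hφ).memLp,
    ← ofReal_integral_norm_sq hD.memLp, ← ofReal_integral_norm_sq hφ2,
    ← ENNReal.ofReal_mul (integral_nonneg fun ω => by positivity),
    ENNReal.ofReal_eq_ofReal_iff (integral_nonneg fun ω => by positivity)
      (mul_nonneg (integral_nonneg fun ω => by positivity)
        (integral_nonneg fun ω => by positivity))] at h
  rw [h]
  congr 1
  simpa using hM.integral_sub_sq hM2 hst

/-- The sum of `(M (u (i+1)) - M (u i)) • φ i` over `i < n`: the integral of a step process. -/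
noncomputable def stepIntegral (M : ℝ≥0 → Ω → ℝ) (u : ℕ → ℝ≥0) (φ : ℕ → Ω → H) (n : ℕ)
    (ω : Ω) : H :=
  ∑ i ∈ Finset.range n, (M (u (i + 1)) ω - M (u i) ω) • φ i ω

theorem IsLevyMartingale.isMartingaleIncrement_stepIntegral (hM : IsLevyMartingale 𝓕 P M)
    (hM2 : MemLp (M 1) 2 P) {u : ℕ → ℝ≥0} (hu : Monotone u) {φ : ℕ → Ω → H}
    (hφ2 : ∀ i, MemLp (φ i) 2 P)
    (hφ : ∀ i, u i < u (i + 1) → AEStronglyMeasurable[𝓕 (u i)] (φ i) P) (n : ℕ) :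
    IsMartingaleIncrement P (𝓕 (u 0)) (𝓕 (u n)) (stepIntegral M u φ n) :=
  IsMartingaleIncrement.sum_range (m := fun i => 𝓕 (u i)) (fun _ _ h => 𝓕.mono (hu h))
    (fun _ => 𝓕.le _)
    (fun i => hM.isMartingaleIncrement_smul hM2 (hu i.le_succ) (hφ2 i) (hφ i)) n

/-- The isometry for integrals of step processes. -/
theorem IsLevyMartingale.integral_norm_sq_stepIntegral (hM : IsLevyMartingale 𝓕 P M)
    (hM2 : MemLp (M 1) 2 P) {u : ℕ → ℝ≥0} (hu : Monotone u) {φ : ℕ → Ω → H}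
    (hφ2 : ∀ i, MemLp (φ i) 2 P)
    (hφ : ∀ i, u i < u (i + 1) → AEStronglyMeasurable[𝓕 (u i)] (φ i) P) (n : ℕ) :
    ∫ ω, ‖stepIntegral M u φ n ω‖ ^ 2 ∂P = ∑ i ∈ Finset.range n,
      (secondMoment P M (u (i + 1)) - secondMoment P M (u i)) * ∫ ω, ‖φ i ω‖ ^ 2 ∂P := by
  refine (IsMartingaleIncrement.integral_norm_sq_sum_range (m := fun i => 𝓕 (u i))
    (fun _ _ h => 𝓕.mono (hu h)) (fun _ => 𝓕.le _)
    (fun i => hM.isMartingaleIncrement_smul hM2 (hu i.le_succ) (hφ2 i) (hφ i)) n).trans ?_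
  exact Finset.sum_congr rfl fun i _ =>
    hM.integral_norm_sq_smul hM2 (hu i.le_succ) (hφ2 i) (hφ i)

end Levy

/-! ### The dyadic Riemann-sum processes -/

section Dyadic

/-- The dyadic point `i 2⁻ⁿ T`, capped at `T`, for an arbitrary natural number `i`. -/
noncomputable def gridPoint (T : ℝ≥0) (n i : ℕ) : Set.Icc (0 : ℝ≥0) T :=
  ⟨min ((i : ℝ≥0) * (2 ^ n)⁻¹ * T) T, zero_le, min_le_right _ _⟩

theorem dyadicPoint_eq_gridPoint (T : ℝ≥0) (n : ℕ) (i : Fin (2 ^ n + 1)) :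
    dyadicPoint T n i = gridPoint T n i :=
  Subtype.ext (min_eq_left (dyadicPoint T n i).2.2).symm

theorem gridPoint_mono (T : ℝ≥0) (n : ℕ) : Monotone (gridPoint T n) := fun i j hij =>
  Subtype.mk_le_mk.2 (by gcongr)

theorem gridPoint_zero (T : ℝ≥0) (n : ℕ) : (gridPoint T n 0 : ℝ≥0) = 0 := by
  simp [gridPoint]

theorem gridPoint_two_pow (T : ℝ≥0) (n : ℕ) : (gridPoint T n (2 ^ n) : ℝ≥0) = T := by
  simp [gridPoint]

theorem gridPoint_succ_le (T : ℝ≥0) (n i : ℕ) :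
    (gridPoint T n (i + 1) : ℝ≥0) ≤ gridPoint T n i + (2 ^ n)⁻¹ * T := by
  simp only [gridPoint]
  rw [min_add]
  refine le_min ((min_le_left _ _).trans ?_) ((min_le_right _ _).trans (by simp))
  push_cast
  apply le_of_eq
  ring

variable {Ω : Type*} {mΩ : MeasurableSpace Ω} {P : Measure Ω} {T : ℝ≥0}
  {H : Type*} [NormedAddCommGroup H] [InnerProductSpace ℝ H]
  {M : ℝ≥0 → Ω → ℝ} {Φ : Set.Icc (0 : ℝ≥0) T → Lp H 2 P}

theorem dyadicProcess_eq_sum_range (n : ℕ) (t : Set.Icc (0 : ℝ≥0) T) (ω : Ω) :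
    dyadicProcess M Φ n t ω = ∑ i ∈ Finset.range (2 ^ n),
      (M (min (t : ℝ≥0) (gridPoint T n (i + 1))) ω
        - M (min (t : ℝ≥0) (gridPoint T n i)) ω) • Φ (gridPoint T n i) ω := by
  rw [← Fin.sum_univ_eq_sum_range (fun i => (M (min (t : ℝ≥0) (gridPoint T n (i + 1))) ω
        - M (min (t : ℝ≥0) (gridPoint T n i)) ω) • Φ (gridPoint T n i) ω)]
  unfold dyadicProcess
  simp_rw [dyadicPoint_eq_gridPoint]
  simp

theorem dyadicProcess_zero (n : ℕ) {t : Set.Icc (0 : ℝ≥0) T} (ht : (t : ℝ≥0) = 0) (ω : Ω) :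
    dyadicProcess M Φ n t ω = 0 := by
  simp [dyadicProcess, ht]

/-- The point `gridPoint T n i` moved into the interval `[s,t]`. -/
noncomputable def clampedGrid (T : ℝ≥0) (n : ℕ) (s t : ℝ≥0) (i : ℕ) : ℝ≥0 :=
  max s (min t (gridPoint T n i))

theorem clampedGrid_mono (T : ℝ≥0) (n : ℕ) (s t : ℝ≥0) : Monotone (clampedGrid T n s t) :=
  fun _ _ hij => max_le_max le_rfl (min_le_min le_rfl (gridPoint_mono T n hij))

theorem clampedGrid_zero (T : ℝ≥0) (n : ℕ) (s t : ℝ≥0) : clampedGrid T n s t 0 = s := by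
  simp [clampedGrid, gridPoint_zero]

theorem clampedGrid_two_pow (n : ℕ) {s t : ℝ≥0} (hst : s ≤ t) (ht : t ≤ T) :
    clampedGrid T n s t (2 ^ n) = t := by
  simp [clampedGrid, gridPoint_two_pow, ht, hst]

/-- Over `[s,t]`, the deviation of the dyadic process from the one-term Riemann sum is the
integral of the step process with values `Φ (gridPoint T n i) - Φ s`. -/
theorem dyadicProcess_sub_sub_smul (n : ℕ) {s t : Set.Icc (0 : ℝ≥0) T} (hst : s ≤ t) (ω : Ω) :
    dyadicProcess M Φ n t ω - dyadicProcess M Φ n s ω - (M t ω - M s ω) • Φ s ω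
      = stepIntegral M (clampedGrid T n s t)
        (fun i ω => Φ (gridPoint T n i) ω - Φ s ω) (2 ^ n) ω := by
  have hst' : (s : ℝ≥0) ≤ t := hst
  have tel : M t ω - M s ω = ∑ i ∈ Finset.range (2 ^ n),
      (M (clampedGrid T n s t (i + 1)) ω - M (clampedGrid T n s t i) ω) := by
    rw [Finset.sum_range_sub (fun i => M (clampedGrid T n s t i) ω), clampedGrid_zero,
      clampedGrid_two_pow n hst' t.2.2]
  have key : ∀ x : ℝ≥0, M (min t x) ω - M (min s x) ω = M (max s (min t x)) ω - M s ω := by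
    intro x
    rcases le_total x s with h | h
    · rw [min_eq_right h, min_eq_right (h.trans hst'), max_eq_left h]; simp
    · rw [min_eq_left h, max_eq_right (le_min hst' h)]
  rw [tel, dyadicProcess_eq_sum_range, dyadicProcess_eq_sum_range, ← Finset.sum_sub_distrib,
    Finset.sum_smul, ← Finset.sum_sub_distrib]
  refine Finset.sum_congr rfl fun i _ => ?_
  have h1 := key (gridPoint T n (i + 1))
  have h0 := key (gridPoint T n i)
  rw [smul_sub, ← sub_smul]
  congr 2
  simp only [clampedGrid]
  linarith

variable [CompleteSpace H] [IsProbabilityMeasure P] {𝓕 : Filtration ℝ≥0 mΩ}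

omit [CompleteSpace H] [IsProbabilityMeasure P] in
theorem IsCAd.aestronglyMeasurable (hΦ : IsCAd 𝓕 Φ) {s : Set.Icc (0 : ℝ≥0) T} {t : ℝ≥0}
    (hst : s ≤ t) : AEStronglyMeasurable[𝓕 t] (Φ s) P :=
  ((mem_lpMeas_iff_aestronglyMeasurable).1 (hΦ.adapted s)).mono (𝓕.mono hst)

omit [CompleteSpace H] [IsProbabilityMeasure P] in
/-- The step process is adapted on every piece of the clamped grid which has positive length; the
other pieces lie before or after `[s,t]` and do not contribute. -/
theorem aestronglyMeasurable_sub_of_clampedGrid_lt (hΦ : IsCAd 𝓕 Φ) (n : ℕ)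
    (s t : Set.Icc (0 : ℝ≥0) T) (i : ℕ)
    (h : clampedGrid T n s t i < clampedGrid T n s t (i + 1)) :
    AEStronglyMeasurable[𝓕 (clampedGrid T n s t i)]
      (fun ω => Φ (gridPoint T n i) ω - Φ s ω) P := by
  refine (hΦ.aestronglyMeasurable ?_).sub (hΦ.aestronglyMeasurable (le_max_left _ _))
  rcases le_total (gridPoint T n i : ℝ≥0) t with h' | h'
  · exact (le_min h' le_rfl).trans (le_max_right _ _)
  · have h'' : (t : ℝ≥0) ≤ gridPoint T n (i + 1) := h'.trans (gridPoint_mono T n i.le_succ)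
    simp [clampedGrid, min_eq_left h', min_eq_left h''] at h

omit [InnerProductSpace ℝ H] [CompleteSpace H] [IsProbabilityMeasure P] in
theorem memLp_sub_coe (s t : Set.Icc (0 : ℝ≥0) T) :
    MemLp (fun ω => Φ s ω - Φ t ω) 2 P :=
  (Lp.memLp (Φ s)).sub (Lp.memLp (Φ t))

theorem IsLevyMartingale.isMartingaleIncrement_dyadicProcess_sub_smul
    (hM : IsLevyMartingale 𝓕 P M) (hM2 : MemLp (M 1) 2 P) (hΦ : IsCAd 𝓕 Φ) (n : ℕ)
    {s t : Set.Icc (0 : ℝ≥0) T} (hst : s ≤ t) :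
    IsMartingaleIncrement P (𝓕 s) (𝓕 t) (fun ω => dyadicProcess M Φ n t ω
      - dyadicProcess M Φ n s ω - (M t ω - M s ω) • Φ s ω) := by
  have h := hM.isMartingaleIncrement_stepIntegral hM2 (clampedGrid_mono T n s t)
    (fun i => memLp_sub_coe (gridPoint T n i) s)
    (aestronglyMeasurable_sub_of_clampedGrid_lt hΦ n s t) (2 ^ n)
  rw [clampedGrid_zero, clampedGrid_two_pow n hst t.2.2] at h
  exact h.congr_ae (ae_of_all _ fun ω => (dyadicProcess_sub_sub_smul n hst ω).symm)

theorem IsLevyMartingale.isMartingaleIncrement_dyadicProcess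
    (hM : IsLevyMartingale 𝓕 P M) (hM2 : MemLp (M 1) 2 P) (hΦ : IsCAd 𝓕 Φ) (n : ℕ)
    {s t : Set.Icc (0 : ℝ≥0) T} (hst : s ≤ t) :
    IsMartingaleIncrement P (𝓕 s) (𝓕 t) (fun ω => dyadicProcess M Φ n t ω
      - dyadicProcess M Φ n s ω) := by
  have h := (hM.isMartingaleIncrement_dyadicProcess_sub_smul hM2 hΦ n hst).add
    (hM.isMartingaleIncrement_smul hM2 (show (s : ℝ≥0) ≤ t from hst) (Lp.memLp (Φ s))
      fun _ => hΦ.aestronglyMeasurable le_rfl)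
  simpa using h

/-- The local estimate: over a short interval, the dyadic process is close to the one-term
Riemann sum, with an error governed by the modulus of continuity of `Φ`. -/
theorem IsLevyMartingale.integral_norm_sq_dyadicProcess_sub_smul_le
    (hM : IsLevyMartingale 𝓕 P M) (hM2 : MemLp (M 1) 2 P) (hΦ : IsCAd 𝓕 Φ) {n : ℕ}
    {s t : Set.Icc (0 : ℝ≥0) T} (hst : s ≤ t) {ε δ : ℝ}
    (hmod : ∀ u v : Set.Icc (0 : ℝ≥0) T, |((u : ℝ≥0) : ℝ) - ((v : ℝ≥0) : ℝ)| ≤ δ →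
      ‖Φ u - Φ v‖ ≤ ε)
    (hn : (2 ^ n)⁻¹ * (T : ℝ) ≤ δ) (hδ : ((t : ℝ≥0) : ℝ) - ((s : ℝ≥0) : ℝ) ≤ δ) :
    ∫ ω, ‖(dyadicProcess M Φ n t ω - dyadicProcess M Φ n s ω - (M t ω - M s ω) • Φ s ω)‖ ^ 2 ∂P
      ≤ (secondMoment P M t - secondMoment P M s) * ε ^ 2 := by
  simp_rw [dyadicProcess_sub_sub_smul n hst]
  rw [hM.integral_norm_sq_stepIntegral hM2 (clampedGrid_mono T n s t)
    (fun i => memLp_sub_coe (gridPoint T n i) s)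
    (aestronglyMeasurable_sub_of_clampedGrid_lt hΦ n s t)]
  have tel : secondMoment P M t - secondMoment P M s = ∑ i ∈ Finset.range (2 ^ n),
      (secondMoment P M (clampedGrid T n s t (i + 1))
        - secondMoment P M (clampedGrid T n s t i)) := by
    rw [Finset.sum_range_sub (fun i => secondMoment P M (clampedGrid T n s t i)),
      clampedGrid_zero, clampedGrid_two_pow n hst t.2.2]
  rw [tel, Finset.sum_mul]
  refine Finset.sum_le_sum fun i _ => ?_
  rcases (clampedGrid_mono T n s t i.le_succ).eq_or_lt with h | h
  · simp [h]
  refine mul_le_mul_of_nonneg_left ?_ (sub_nonneg.2 (hM.secondMoment_mono hM2 h.le))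
  -- A nontrivial piece of the clamped grid comes from a grid point within `δ` of `s`.
  have hclose : |((gridPoint T n i : ℝ≥0) : ℝ) - ((s : ℝ≥0) : ℝ)| ≤ δ := by
    have hlt : (gridPoint T n i : ℝ≥0) < t := by
      by_contra! h'
      have h'' : (t : ℝ≥0) ≤ gridPoint T n (i + 1) := h'.trans (gridPoint_mono T n i.le_succ)
      simp [clampedGrid, min_eq_left h', min_eq_left h''] at h
    have hlt' : (s : ℝ≥0) < gridPoint T n (i + 1) := by
      by_contra! h'
      have h1 : clampedGrid T n s t (i + 1) = s :=
        max_eq_left ((min_le_right _ _).trans h')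
      rw [h1] at h
      exact absurd (le_max_left _ _) h.not_ge
    have h3 := hlt'.trans_le (gridPoint_succ_le T n i)
    have h4 : ((s : ℝ≥0) : ℝ) < ((gridPoint T n i : ℝ≥0) : ℝ) + (2 ^ n)⁻¹ * (T : ℝ) := by
      exact_mod_cast h3
    have h5 : ((gridPoint T n i : ℝ≥0) : ℝ) < ((t : ℝ≥0) : ℝ) := by exact_mod_cast hlt
    rw [abs_le]
    constructor <;> linarith
  have hε := hmod _ _ hclose
  have e : ∫ ω, ‖Φ (gridPoint T n i) ω - Φ s ω‖ ^ 2 ∂P = ‖Φ (gridPoint T n i) - Φ s‖ ^ 2 := by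
    rw [← real_inner_self_eq_norm_sq, L2.inner_def]
    refine integral_congr_ae ?_
    filter_upwards [Lp.coeFn_sub (Φ (gridPoint T n i)) (Φ s)] with ω hω
    rw [hω, real_inner_self_eq_norm_sq, Pi.sub_apply]
  rw [e]
  gcongr

/-- The global estimate: the dyadic process at the end point of a partition is close to the Riemann
sum, because the errors over the intervals of the partition are martingale increments. -/
theorem IsLevyMartingale.integral_norm_sq_dyadicProcess_sub_sum_le
    (hM : IsLevyMartingale 𝓕 P M) (hM2 : MemLp (M 1) 2 P) (hΦ : IsCAd 𝓕 Φ) {n : ℕ} {ε δ : ℝ}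
    (hmod : ∀ u v : Set.Icc (0 : ℝ≥0) T, |((u : ℝ≥0) : ℝ) - ((v : ℝ≥0) : ℝ)| ≤ δ →
      ‖Φ u - Φ v‖ ≤ ε)
    (hn : (2 ^ n)⁻¹ * (T : ℝ) ≤ δ) {u : ℕ → Set.Icc (0 : ℝ≥0) T} (hu : Monotone u)
    (hu0 : (u 0 : ℝ≥0) = 0)
    (hδ : ∀ i, ((u (i + 1) : ℝ≥0) : ℝ) - ((u i : ℝ≥0) : ℝ) ≤ δ) (k : ℕ) :
    MemLp (fun ω => dyadicProcess M Φ n (u k) ω -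
        ∑ i ∈ Finset.range k, (M (u (i + 1)) ω - M (u i) ω) • Φ (u i) ω) 2 P ∧
    ∫ ω, ‖(dyadicProcess M Φ n (u k) ω -
        ∑ i ∈ Finset.range k, (M (u (i + 1)) ω - M (u i) ω) • Φ (u i) ω)‖ ^ 2 ∂P
      ≤ secondMoment P M (u k) * ε ^ 2 := by
  have e : ∀ ω, dyadicProcess M Φ n (u k) ω -
      ∑ i ∈ Finset.range k, (M (u (i + 1)) ω - M (u i) ω) • Φ (u i) ω
      = ∑ i ∈ Finset.range k, (dyadicProcess M Φ n (u (i + 1)) ω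
        - dyadicProcess M Φ n (u i) ω - (M (u (i + 1)) ω - M (u i) ω) • Φ (u i) ω) := by
    intro ω
    rw [Finset.sum_sub_distrib, Finset.sum_range_sub (fun i => dyadicProcess M Φ n (u i) ω),
      dyadicProcess_zero n hu0, sub_zero]
  have hinc := fun i =>
    hM.isMartingaleIncrement_dyadicProcess_sub_smul hM2 hΦ n (hu (Nat.le_succ i))
  have hmono : Monotone fun i => (𝓕 (u i : ℝ≥0) : MeasurableSpace Ω) :=
    fun i j hij => 𝓕.mono (hu hij)
  simp_rw [e]
  refine ⟨(IsMartingaleIncrement.sum_range hmono (fun _ => 𝓕.le _) hinc k).memLp, ?_⟩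
  rw [IsMartingaleIncrement.integral_norm_sq_sum_range hmono (fun _ => 𝓕.le _) hinc k]
  calc _ ≤ ∑ i ∈ Finset.range k,
        (secondMoment P M (u (i + 1)) - secondMoment P M (u i)) * ε ^ 2 :=
        Finset.sum_le_sum fun i _ => hM.integral_norm_sq_dyadicProcess_sub_smul_le hM2 hΦ
          (hu i.le_succ) hmod hn (hδ i)
    _ = _ := by
        rw [← Finset.sum_mul, Finset.sum_range_sub (fun i => secondMoment P M (u i)), hu0,
          hM.secondMoment_zero, sub_zero]

end Dyadic

/-! ### Doob's maximal inequality in `L²` -/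

section Doob

/-- The pathwise form of Doob's inequality: a running maximum `S` of a nonnegative sequence is
controlled by its last term, up to a discrete stochastic integral of `S`. -/
theorem partialSups_sq_add_sum_le {x : ℕ → ℝ} (hx : ∀ k, 0 ≤ x k) (n : ℕ) :
    partialSups x n ^ 2 + 4 * ∑ k ∈ Finset.range n, partialSups x k * (x (k + 1) - x k)
      ≤ 4 * x n ^ 2 := by
  -- Summation by parts, using that `x` equals its running maximum whenever the latter increases.
  have key : partialSups x n ^ 2 + 2 * ∑ k ∈ Finset.range n, partialSups x k * (x (k + 1) - x k)
      ≤ 2 * (partialSups x n * x n) := by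
    induction n with
    | zero => simp; nlinarith [sq_nonneg (x 0)]
    | succ n ih =>
      rw [Finset.sum_range_succ, ← Order.succ_eq_add_one, partialSups_succ, Order.succ_eq_add_one]
      have hS : 0 ≤ partialSups x n := (hx n).trans (le_partialSups x n)
      rcases le_total (partialSups x n) (x (n + 1)) with h | h
      · rw [sup_eq_right.2 h]
        nlinarith [sq_nonneg (x (n + 1) - partialSups x n)]
      · rw [sup_eq_left.2 h]
        nlinarith
  nlinarith [sq_nonneg (partialSups x n - 2 * x n)]

variable {Ω : Type*} {mΩ : MeasurableSpace Ω} {P : Measure Ω} [IsProbabilityMeasure P]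
  {H : Type*} [NormedAddCommGroup H] [InnerProductSpace ℝ H] [CompleteSpace H]

omit [IsProbabilityMeasure P] [InnerProductSpace ℝ H] [CompleteSpace H] in
theorem memLp_partialSups_norm {x : ℕ → Ω → H} (hx : ∀ k, MemLp (x k) 2 P) (n : ℕ) :
    MemLp (fun ω => partialSups (fun j => ‖x j ω‖) n) 2 P := by
  induction n with
  | zero => simpa using (hx 0).norm
  | succ n ih =>
    simp_rw [← Order.succ_eq_add_one, partialSups_succ]
    exact ih.sup (hx _).norm

omit [InnerProductSpace ℝ H] [CompleteSpace H] in
theorem stronglyMeasurable_partialSups_norm {m : ℕ → MeasurableSpace Ω} (hm : Monotone m)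
    {x : ℕ → Ω → H} (hx : ∀ k, StronglyMeasurable[m k] (x k)) (n : ℕ) :
    StronglyMeasurable[m n] (fun ω => partialSups (fun j => ‖x j ω‖) n) := by
  induction n with
  | zero => simpa using (hx 0).norm
  | succ n ih =>
    simp_rw [← Order.succ_eq_add_one, partialSups_succ]
    exact @StronglyMeasurable.sup _ _ _ _ (m (n + 1)) _ _ _ (ih.mono (hm n.le_succ)) (hx _).norm

/-- Doob's `L²` inequality for a martingale in discrete time. -/
theorem integral_partialSups_norm_sq_le {m : ℕ → MeasurableSpace Ω} (hm : Monotone m)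
    (hmΩ : ∀ k, m k ≤ mΩ) {x : ℕ → Ω → H} (hx : ∀ k, MemLp (x k) 2 P)
    (hxm : ∀ k, StronglyMeasurable[m k] (x k)) (hmart : ∀ k, P[x (k + 1) | m k] =ᵐ[P] x k)
    (n : ℕ) :
    ∫ ω, partialSups (fun j => ‖x j ω‖) n ^ 2 ∂P ≤ 4 * ∫ ω, ‖x n ω‖ ^ 2 ∂P := by
  set S : ℕ → Ω → ℝ := fun k ω => partialSups (fun j => ‖x j ω‖) k with hSdef
  have hS0 : ∀ k ω, 0 ≤ S k ω := fun k ω =>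
    (norm_nonneg _).trans (le_partialSups (fun j => ‖x j ω‖) k)
  have hS2 : ∀ k, MemLp (S k) 2 P := memLp_partialSups_norm hx
  have i1 : ∀ k, Integrable (fun ω => S k ω * ‖x (k + 1) ω‖) P := fun k =>
    (hS2 k).integrable_mul (hx (k + 1)).norm
  have i0 : ∀ k, Integrable (fun ω => S k ω * ‖x k ω‖) P := fun k =>
    (hS2 k).integrable_mul (hx k).norm
  -- The norm of a martingale is a submartingale, so the discrete integral has mean `≥ 0`.
  have sub : ∀ k, 0 ≤ ∫ ω, S k ω * (‖x (k + 1) ω‖ - ‖x k ω‖) ∂P := by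
    intro k
    simp_rw [mul_sub]
    rw [integral_sub (i1 k) (i0 k), sub_nonneg,
      ← integral_condExp (hmΩ k) (f := fun ω => S k ω * ‖x (k + 1) ω‖)]
    refine integral_mono_ae (i0 k) integrable_condExp ?_
    have h1 := condExp_mul_of_stronglyMeasurable_left (μ := P) (g := fun ω => ‖x (k + 1) ω‖)
      (stronglyMeasurable_partialSups_norm hm hxm k)
      (i1 k) ((hx (k + 1)).norm.integrable one_le_two)
    filter_upwards [h1, norm_condExp_le (μ := P) (m := m k) (x (k + 1)), hmart k]
      with ω h1 h2 h3
    rw [h3] at h2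
    refine (mul_le_mul_of_nonneg_left h2 (hS0 k ω)).trans (le_of_eq ?_)
    exact h1.symm
  have i2 : ∀ k, Integrable (fun ω => S k ω * (‖x (k + 1) ω‖ - ‖x k ω‖)) P := fun k => by
    simp_rw [mul_sub]
    exact (i1 k).sub (i0 k)
  have isum : Integrable (fun ω => 4 * ∑ k ∈ Finset.range n,
      S k ω * (‖x (k + 1) ω‖ - ‖x k ω‖)) P :=
    (integrable_finsetSum _ fun k _ => i2 k).const_mul 4
  have hmain := integral_mono ((hS2 n).integrable_sq.add isum)
    (((hx n).integrable_norm_pow two_ne_zero).const_mul 4)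
    (fun ω => partialSups_sq_add_sum_le (x := fun j => ‖x j ω‖) (fun _ => norm_nonneg _) n)
  rw [integral_const_mul] at hmain
  have e := integral_add (hS2 n).integrable_sq isum
  rw [integral_const_mul, integral_finsetSum _ fun k _ => i2 k] at e
  have hpos := Finset.sum_nonneg fun k (_ : k ∈ Finset.range n) => sub k
  simp only [Pi.add_apply] at hmain e
  linarith

variable {𝓕 : Filtration ℝ≥0 mΩ} {T : ℝ≥0} {X Y : Set.Icc (0 : ℝ≥0) T → Ω → H}

/-- Every point of `[0,T]` is approached from the right by grid points. -/
theorem exists_gridPoint_tendsto (t : Set.Icc (0 : ℝ≥0) T) :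
    ∃ i : ℕ → ℕ, (∀ n, i n ≤ 2 ^ n) ∧
      Tendsto (fun n => gridPoint T n (i n)) atTop (𝓝[Set.Ici t] t) := by
  rcases eq_or_ne T 0 with rfl | hT
  · have hs : ∀ s : Set.Icc (0 : ℝ≥0) 0, s = t := fun s =>
      Subtype.ext ((le_antisymm s.2.2 s.2.1).trans (le_antisymm t.2.2 t.2.1).symm)
    refine ⟨fun _ => 0, fun _ => Nat.zero_le _, ?_⟩
    simp_rw [hs]
    exact tendsto_const_nhdsWithin Set.self_mem_Ici
  have hTpos : 0 < T := pos_iff_ne_zero.2 hT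
  refine ⟨fun n => ⌈(t : ℝ≥0) * 2 ^ n / T⌉₊, fun n => ?_, ?_⟩
  · refine Nat.ceil_le.2 ?_
    rw [div_le_iff₀ hTpos, mul_comm]
    push_cast
    gcongr
    exact t.2.2
  have hlow : ∀ n, t ≤ gridPoint T n ⌈(t : ℝ≥0) * 2 ^ n / T⌉₊ := by
    intro n
    refine Subtype.coe_le_coe.1 (le_min ?_ t.2.2)
    calc (t : ℝ≥0) = (t * 2 ^ n / T) * (2 ^ n)⁻¹ * T := by field_simp
      _ ≤ _ := by gcongr; exact Nat.le_ceil _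
  refine tendsto_nhdsWithin_iff.2 ⟨?_, Eventually.of_forall hlow⟩
  rw [tendsto_subtype_rng]
  have hup : ∀ n, (gridPoint T n ⌈(t : ℝ≥0) * 2 ^ n / T⌉₊ : ℝ≥0) ≤ t + (2 ^ n)⁻¹ * T := by
    intro n
    refine (min_le_left _ _).trans ?_
    calc (⌈(t : ℝ≥0) * 2 ^ n / T⌉₊ : ℝ≥0) * (2 ^ n)⁻¹ * T
        ≤ (t * 2 ^ n / T + 1) * (2 ^ n)⁻¹ * T := by
          gcongr; exact (Nat.ceil_lt_add_one zero_le).le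
      _ = _ := by field_simp
  refine tendsto_of_tendsto_of_tendsto_of_le_of_le tendsto_const_nhds ?_
    (fun n => Subtype.coe_le_coe.2 (hlow n)) hup
  have h0 : Tendsto (fun n : ℕ => ((2 : ℝ≥0) ^ n)⁻¹) atTop (𝓝 0) := by
    simp_rw [← inv_pow]
    exact NNReal.tendsto_pow_atTop_nhds_zero_of_lt_one (by
      rw [← NNReal.coe_lt_coe]; norm_num)
  simpa using (tendsto_const_nhds (x := (t : ℝ≥0))).add (h0.mul_const T)

/-- Doob's `L²` inequality for càdlàg martingales. The supremum over `[0,T]` is replaced by a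
measurable majorant, the lower limit of the maxima over the dyadic grids. -/
theorem MemM2.exists_measurable_majorant (hX : MemM2 𝓕 P X) :
    ∃ G : Ω → ℝ≥0∞, Measurable G ∧ (∀ ω t, ‖X t ω‖ₑ ^ 2 ≤ G ω) ∧
      ∫⁻ ω, G ω ∂P ≤ 4 * eLpNorm (X ⟨T, zero_le, le_rfl⟩) 2 P ^ 2 := by
  set S : ℕ → Ω → ℝ := fun n ω => partialSups (fun j => ‖X (gridPoint T n j) ω‖) (2 ^ n)
  have hmono : ∀ n, Monotone fun j => (restrictIcc 𝓕 T (gridPoint T n j) : MeasurableSpace Ω) :=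
    fun n i j hij => (restrictIcc 𝓕 T).mono (gridPoint_mono T n hij)
  have hSm : ∀ n, Measurable (S n) := fun n =>
    ((stronglyMeasurable_partialSups_norm (hmono n)
      (fun j => hX.martingale.1 (gridPoint T n j)) (2 ^ n)).mono
        ((restrictIcc 𝓕 T).le _)).measurable
  have hGm : ∀ n, Measurable fun ω => ENNReal.ofReal (S n ω ^ 2) := fun n =>
    ((hSm n).pow_const 2).ennreal_ofReal
  refine ⟨fun ω => liminf (fun n => ENNReal.ofReal (S n ω ^ 2)) atTop, .liminf hGm, ?_, ?_⟩
  · intro ω t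
    obtain ⟨i, hi, hit⟩ := exists_gridPoint_tendsto t
    have h1 : Tendsto (fun n => ‖X (gridPoint T n (i n)) ω‖ₑ ^ 2) atTop (𝓝 (‖X t ω‖ₑ ^ 2)) :=
      ((ENNReal.continuous_pow 2).comp continuous_enorm).continuousAt.tendsto.comp
        ((hX.cadlag ω t).1.tendsto.comp hit)
    rw [← h1.liminf_eq]
    refine liminf_le_liminf (Eventually.of_forall fun n => ?_)
    have h2 : ‖X (gridPoint T n (i n)) ω‖ ≤ S n ω :=
      le_partialSups_of_le (fun j => ‖X (gridPoint T n j) ω‖) (hi n)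
    calc ‖X (gridPoint T n (i n)) ω‖ₑ ^ 2
        = ENNReal.ofReal (‖X (gridPoint T n (i n)) ω‖ ^ 2) := by
          rw [ENNReal.ofReal_pow (norm_nonneg _), ofReal_norm]
      _ ≤ _ := by gcongr
  · refine (lintegral_liminf_le hGm).trans ?_
    refine liminf_le_of_frequently_le' (Frequently.of_forall fun n => ?_)
    have hmem := fun j => hX.memLp (gridPoint T n j)
    have h := integral_partialSups_norm_sq_le (P := P) (hmono n)
      (fun _ => (restrictIcc 𝓕 T).le _) hmem
      (fun j => hX.martingale.1 (gridPoint T n j))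
      (fun j => hX.martingale.2 _ _ (gridPoint_mono T n j.le_succ)) (2 ^ n)
    have hT : gridPoint T n (2 ^ n) = ⟨T, zero_le, le_rfl⟩ :=
      Subtype.ext (gridPoint_two_pow T n)
    rw [← ofReal_integral_eq_lintegral_ofReal
      (memLp_partialSups_norm hmem (2 ^ n)).integrable_sq (ae_of_all _ fun ω => sq_nonneg _),
      ← lintegral_enorm_sq_eq_eLpNorm_sq, ← ofReal_integral_norm_sq (hX.memLp _), ← hT]
    refine (ENNReal.ofReal_le_ofReal h).trans ?_
    rw [ENNReal.ofReal_mul (by norm_num)]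
    simp

theorem MemM2.normM2_le (hX : MemM2 𝓕 P X) :
    normM2 P X ≤ 2 * eLpNorm (X ⟨T, zero_le, le_rfl⟩) 2 P := by
  obtain ⟨G, -, hG, hint⟩ := hX.exists_measurable_majorant
  have h : ∫⁻ ω, ⨆ t, ‖X t ω‖ₑ ^ 2 ∂P
      ≤ (2 * eLpNorm (X ⟨T, zero_le, le_rfl⟩) 2 P) ^ 2 := by
    refine (lintegral_mono fun ω => iSup_le (hG ω)).trans (hint.trans (le_of_eq ?_))
    rw [mul_pow]
    norm_num
  refine (ENNReal.rpow_le_rpow h (by norm_num)).trans (le_of_eq ?_)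
  rw [← ENNReal.rpow_natCast, ← ENNReal.rpow_mul]
  norm_num

theorem MemM2.normM2_lt_top (hX : MemM2 𝓕 P X) : normM2 P X < ∞ :=
  hX.normM2_le.trans_lt (ENNReal.mul_lt_top (by simp) (hX.memLp _).2)

theorem IsCadlag.sub {ι E : Type*} [TopologicalSpace ι] [Preorder ι] [NormedAddCommGroup E]
    {f g : ι → E} (hf : IsCadlag f) (hg : IsCadlag g) : IsCadlag (fun t => f t - g t) := fun t =>
  ⟨(hf t).1.sub (hg t).1, by
    obtain ⟨a, ha⟩ := (hf t).2
    obtain ⟨b, hb⟩ := (hg t).2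
    exact ⟨a - b, ha.sub hb⟩⟩

omit [IsProbabilityMeasure P] in
theorem MemM2.sub (hX : MemM2 𝓕 P X) (hY : MemM2 𝓕 P Y) :
    MemM2 𝓕 P (fun t ω => X t ω - Y t ω) where
  martingale := hX.martingale.sub hY.martingale
  cadlag ω := (hX.cadlag ω).sub (hY.cadlag ω)
  memLp t := (hX.memLp t).sub (hY.memLp t)

end Doob

/-! ### Limits of càdlàg martingales -/

section Limits

theorem IsCadlag.of_tendstoUniformly {ι E : Type*} [TopologicalSpace ι] [Preorder ι]
    [NormedAddCommGroup E] [CompleteSpace E] {f : ℕ → ι → E} {g : ι → E}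
    (hf : ∀ n, IsCadlag (f n)) (h : TendstoUniformly f g atTop) : IsCadlag g := by
  intro t
  refine ⟨h.tendsto_of_eventually_tendsto (Eventually.of_forall fun n => (hf n t).1)
    (h.tendsto_at t), ?_⟩
  rcases eq_or_neBot (𝓝[<] t) with hbot | hne
  · exact ⟨g t, by simp [hbot]⟩
  choose L hL using fun n => (hf n t).2
  have hcauchy : CauchySeq L := by
    have hu := Metric.uniformCauchySeqOn_iff.1
      (tendstoUniformlyOn_univ.2 h).uniformCauchySeqOn
    refine Metric.cauchySeq_iff.2 fun ε hε => ?_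
    obtain ⟨N, hN⟩ := hu (ε / 2) (half_pos hε)
    refine ⟨N, fun m hm n hn => lt_of_le_of_lt ?_ (half_lt_self hε)⟩
    exact le_of_tendsto ((hL m).dist (hL n))
      (Eventually.of_forall fun x => (hN m hm n hn x (Set.mem_univ x)).le)
  obtain ⟨l, hl⟩ := cauchySeq_tendsto_of_complete hcauchy
  exact ⟨l, h.tendsto_of_eventually_tendsto (Eventually.of_forall hL) hl⟩

variable {Ω : Type*} {mΩ : MeasurableSpace Ω} {P : Measure Ω} [IsProbabilityMeasure P]
  {H : Type*} [NormedAddCommGroup H] [InnerProductSpace ℝ H] [CompleteSpace H]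
  {𝓕 : Filtration ℝ≥0 mΩ} {T : ℝ≥0}

omit [IsProbabilityMeasure P] in
theorem UsualConditions.measurableSet_of_measure_eq_zero (h𝓕 : UsualConditions 𝓕 P)
    {s : Set Ω} (hs : P s = 0) (t : ℝ≥0) : MeasurableSet[𝓕 t] s :=
  𝓕.mono zero_le s (h𝓕.complete s hs)

omit [InnerProductSpace ℝ H] [CompleteSpace H] in
omit [IsProbabilityMeasure P] in
/-- Over a complete filtration, measurability up to a null set is measurability. -/
theorem UsualConditions.stronglyMeasurable [TopologicalSpace.SeparableSpace H]
    (h𝓕 : UsualConditions 𝓕 P) {t : ℝ≥0} {f : Ω → H} (hf : AEStronglyMeasurable[𝓕 t] f P) :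
    StronglyMeasurable[𝓕 t] f := by
  borelize H
  have : SecondCountableTopology H := UniformSpace.secondCountable_of_separable H
  have hg : Measurable[𝓕 t] (hf.mk f) := hf.stronglyMeasurable_mk.measurable
  have hN : P {ω | f ω = hf.mk f ω}ᶜ = 0 := hf.ae_eq_mk
  suffices Measurable[𝓕 t] f from this.stronglyMeasurable
  intro B hB
  have hsplit : f ⁻¹' B = (hf.mk f ⁻¹' B ∩ {ω | f ω = hf.mk f ω})
      ∪ (f ⁻¹' B ∩ {ω | f ω = hf.mk f ω}ᶜ) := by
    ext ω
    by_cases hω : f ω = hf.mk f ω <;> simp [hω]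
  rw [hsplit]
  refine MeasurableSet.union (MeasurableSet.inter (hg hB) ?_) ?_
  · exact (h𝓕.measurableSet_of_measure_eq_zero hN t).of_compl
  · exact h𝓕.measurableSet_of_measure_eq_zero (measure_mono_null Set.inter_subset_right hN) t

variable {X : ℕ → Set.Icc (0 : ℝ≥0) T → Ω → H} {Y : Set.Icc (0 : ℝ≥0) T → Ω → H}

/-- The martingale property passes to limits in `L²`. -/
theorem martingale_of_tendsto_eLpNorm (hX : ∀ n, MemM2 𝓕 P (X n))
    (hYad : StronglyAdapted (restrictIcc 𝓕 T) Y) (hY2 : ∀ t, MemLp (Y t) 2 P)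
    (hlim : ∀ t, Tendsto (fun n => eLpNorm (X n t - Y t) 2 P) atTop (𝓝 0)) :
    Martingale Y (restrictIcc 𝓕 T) P := by
  refine ⟨hYad, fun s t hst => ?_⟩
  set m : MeasurableSpace Ω := restrictIcc 𝓕 T s
  have hm : m ≤ mΩ := (restrictIcc 𝓕 T).le s
  have hce : MemLp (P[Y t | m]) 2 P := (hY2 t).condExp one_le_two
  have hdiff := (hce.sub (hY2 s)).1
  suffices h : eLpNorm (P[Y t | m] - Y s) 2 P = 0 by
    rw [eLpNorm_eq_zero_iff hdiff two_ne_zero] at h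
    filter_upwards [h] with ω hω
    exact sub_eq_zero.1 hω
  have hbound : ∀ n, eLpNorm (P[Y t | m] - Y s) 2 P
      ≤ eLpNorm (X n t - Y t) 2 P + eLpNorm (X n s - Y s) 2 P := by
    intro n
    have h1 : P[Y t | m] - Y s =ᵐ[P] P[Y t - X n t | m] + (X n s - Y s) := by
      filter_upwards [condExp_sub ((hY2 t).integrable one_le_two)
        (((hX n).memLp t).integrable one_le_two) m, (hX n).martingale.2 s t hst] with ω h2 h3
      simp only [Pi.sub_apply, Pi.add_apply] at h2 ⊢
      rw [h2, h3]
      abel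
    rw [eLpNorm_congr_ae h1, eLpNorm_sub_comm (X n t)]
    refine (eLpNorm_add_le integrable_condExp.1 (((hX n).memLp s).sub (hY2 s)).1
      one_le_two).trans ?_
    gcongr
    exact eLpNorm_condExp_le_eLpNorm _ one_le_two
  have hzero := (hlim t).add (hlim s)
  rw [add_zero] at hzero
  exact le_antisymm (ge_of_tendsto' hzero hbound) zero_le

/-- Almost surely, a rapidly convergent sequence of càdlàg martingales converges uniformly, since
by Doob's inequality the suprema of its increments are summable. -/
theorem exists_ae_tendstoUniformly (hX : ∀ n, MemM2 𝓕 P (X n)) {Z : Ω → H}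
    (hZ : MemLp Z 2 P)
    (hfast : ∀ k, eLpNorm (X k ⟨T, zero_le, le_rfl⟩ - Z) 2 P
      ≤ ENNReal.ofReal ((1 / 2) ^ (k + 2))) :
    ∀ᵐ ω ∂P, ∃ g : Set.Icc (0 : ℝ≥0) T → H, TendstoUniformly (fun k t => X k t ω) g atTop := by
  choose G hGm hGdom hGint using fun k => ((hX (k + 1)).sub (hX k)).exists_measurable_majorant
  have hG4 : ∀ k, ∫⁻ ω, G k ω ∂P ≤ ENNReal.ofReal ((1 / 4) ^ k) := by
    intro k
    refine (hGint k).trans ?_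
    have h1 : eLpNorm (fun ω => X (k + 1) ⟨T, zero_le, le_rfl⟩ ω
        - X k ⟨T, zero_le, le_rfl⟩ ω) 2 P
        ≤ ENNReal.ofReal ((1 / 2) ^ (k + 1)) := by
      have e : (fun ω => X (k + 1) ⟨T, zero_le, le_rfl⟩ ω - X k ⟨T, zero_le, le_rfl⟩ ω)
          = (X (k + 1) ⟨T, zero_le, le_rfl⟩ - Z) - (X k ⟨T, zero_le, le_rfl⟩ - Z) := by
        ext ω; simp
      rw [e]
      refine (eLpNorm_sub_le (((hX _).memLp _).sub hZ).1 (((hX _).memLp _).sub hZ).1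
        one_le_two).trans ((add_le_add (hfast (k + 1)) (hfast k)).trans ?_)
      rw [← ENNReal.ofReal_add (by positivity) (by positivity)]
      refine ENNReal.ofReal_le_ofReal ?_
      have : (0 : ℝ) < (1 / 2) ^ k := by positivity
      simp only [pow_succ]
      linarith
    calc 4 * _ ^ 2 ≤ 4 * ENNReal.ofReal ((1 / 2) ^ (k + 1)) ^ 2 := by gcongr
      _ = ENNReal.ofReal (4 * ((1 / 2) ^ (k + 1)) ^ 2) := by
        rw [ENNReal.ofReal_mul (by norm_num),
          ENNReal.ofReal_pow (p := (1 / 2) ^ (k + 1)) (by positivity) 2, ENNReal.ofReal_ofNat]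
      _ = _ := by
        congr 1
        rw [← pow_mul, mul_comm (k + 1) 2, pow_mul, pow_succ]
        norm_num
        ring
  have hsum : ∫⁻ ω, ∑' k, ENNReal.ofReal (2 ^ k) * G k ω ∂P ≠ ∞ := by
    rw [lintegral_tsum fun k => ((hGm k).const_mul _).aemeasurable]
    refine ne_top_of_le_ne_top (b := ∑' k : ℕ, ENNReal.ofReal ((1 / 2) ^ k)) ?_
      (ENNReal.tsum_le_tsum fun k => ?_)
    · rw [← ENNReal.ofReal_tsum_of_nonneg (fun k => by positivity) summable_geometric_two]
      exact ENNReal.ofReal_ne_top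
    · rw [lintegral_const_mul _ (hGm k)]
      calc _ ≤ ENNReal.ofReal (2 ^ k) * ENNReal.ofReal ((1 / 4) ^ k) := by gcongr; exact hG4 k
        _ = _ := by
          rw [← ENNReal.ofReal_mul (by positivity), ← mul_pow]
          norm_num
  filter_upwards [ae_lt_top' (Measurable.tsum fun k =>
    (hGm k).const_mul _).aemeasurable hsum] with ω hω
  have hterm : ∀ k, ENNReal.ofReal (2 ^ k) * G k ω ≠ ∞ := ENNReal.ne_top_of_tsum_ne_top hω.ne
  have hb : Summable fun k => (1 / 2 : ℝ) ^ k + (ENNReal.ofReal (2 ^ k) * G k ω).toReal :=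
    summable_geometric_two.add (ENNReal.summable_toReal hω.ne)
  have hinc : ∀ k t, ‖X (k + 1) t ω - X k t ω‖
      ≤ (1 / 2 : ℝ) ^ k + (ENNReal.ofReal (2 ^ k) * G k ω).toReal := by
    intro k t
    set r := ‖X (k + 1) t ω - X k t ω‖
    have h1 : 2 ^ k * r ^ 2 ≤ (ENNReal.ofReal (2 ^ k) * G k ω).toReal := by
      rw [← ENNReal.ofReal_le_iff_le_toReal (hterm k), ENNReal.ofReal_mul (by positivity),
        ENNReal.ofReal_pow (norm_nonneg _), ofReal_norm]
      gcongr
      exact hGdom k ω t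
    -- `r ≤ 2⁻ᵏ + 2ᵏ r²` by the inequality of arithmetic and geometric means.
    have h2 : r ≤ (1 / 2) ^ k + 2 ^ k * r ^ 2 := by
      have hq : (0 : ℝ) < 2 ^ k := by positivity
      rw [one_div, inv_pow, ← sub_nonneg]
      have : ((2 : ℝ) ^ k)⁻¹ + 2 ^ k * r ^ 2 - r
          = ((2 ^ k * r - 1) ^ 2 + 2 ^ k * r) / 2 ^ k := by
        field_simp
        ring
      rw [this]
      have hr : 0 ≤ r := norm_nonneg _
      positivity
    linarith
  refine ⟨fun t => X 0 t ω + ∑' k, (X (k + 1) t ω - X k t ω), ?_⟩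
  have h := tendstoUniformly_tsum_nat (f := fun k t => X (k + 1) t ω - X k t ω) hb hinc
  rw [Metric.tendstoUniformly_iff] at h ⊢
  intro ε hε
  filter_upwards [h ε hε] with N hN t
  have e := hN t
  rw [Finset.sum_range_sub (fun k => X k t ω)] at e
  rwa [dist_eq_norm, ← sub_sub_eq_add_sub, sub_sub_eq_add_sub, add_comm (X 0 t ω),
    add_sub_assoc, ← neg_sub, ← sub_eq_add_neg, ← dist_eq_norm]

/-- A sequence of càdlàg martingales which converges in `L²` at every time has a càdlàg limit,
and converges to it in the norm of `𝓜²`. -/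
theorem exists_memM2_modification (h𝓕 : UsualConditions 𝓕 P) (hX : ∀ n, MemM2 𝓕 P (X n))
    (hY2 : ∀ t, MemLp (Y t) 2 P)
    (hlim : ∀ t, Tendsto (fun n => eLpNorm (X n t - Y t) 2 P) atTop (𝓝 0)) :
    ∃ I : Set.Icc (0 : ℝ≥0) T → Ω → H, IsModification P I Y ∧ MemM2 𝓕 P I ∧
      Tendsto (fun n => normM2 P (fun t ω => X n t ω - I t ω)) atTop (𝓝 0) := by
  classical
  obtain ⟨φ, hφ, hfast⟩ := extraction_forall_of_eventually
    (P := fun k n => eLpNorm (X n ⟨T, zero_le, le_rfl⟩ - Y ⟨T, zero_le, le_rfl⟩) 2 P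
      ≤ ENNReal.ofReal ((1 / 2) ^ (k + 2)))
    (fun k => (hlim ⟨T, zero_le, le_rfl⟩).eventually_le_const
      (ENNReal.ofReal_pos.2 (by positivity)))
  have hae := exists_ae_tendstoUniformly (fun k => hX (φ k)) (hY2 _) hfast
  set A : Set Ω := {ω | ∃ g : Set.Icc (0 : ℝ≥0) T → H,
    TendstoUniformly (fun k t => X (φ k) t ω) g atTop}
  choose! g hg using fun ω (hω : ω ∈ A) => hω
  have hA : P Aᶜ = 0 := hae
  set I : Set.Icc (0 : ℝ≥0) T → Ω → H := fun t ω => if ω ∈ A then g ω t else 0 with hI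
  have hIt : ∀ t, Tendsto (fun k ω => A.indicator (X (φ k) t) ω) atTop (𝓝 (I t)) := by
    intro t
    refine tendsto_pi_nhds.2 fun ω => ?_
    by_cases hω : ω ∈ A
    · simpa [hI, hω] using (hg ω hω).tendsto_at t
    · simp [hI, hω]
  have hAd : StronglyAdapted (restrictIcc 𝓕 T) I := fun t =>
    stronglyMeasurable_of_tendsto atTop (fun k => ((hX (φ k)).martingale.1 t).indicator
      (h𝓕.measurableSet_of_measure_eq_zero hA t).of_compl) (hIt t)
  have hmod : IsModification P I Y := by
    intro t
    have hmeas := tendstoInMeasure_of_tendsto_eLpNorm two_ne_zero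
      (fun k => ((hX (φ k)).memLp t).1) (hY2 t).1 ((hlim t).comp hφ.tendsto_atTop)
    obtain ⟨ns, hns, hconv⟩ := hmeas.exists_seq_tendsto_ae
    filter_upwards [hconv, hae] with ω h1 h2
    have h3 := ((hg ω h2).tendsto_at t).comp hns.tendsto_atTop
    have e : I t ω = g ω t := if_pos h2
    rw [e]
    exact tendsto_nhds_unique h3 h1
  have hI2 : ∀ t, MemLp (I t) 2 P := fun t => (hY2 t).ae_eq (EventuallyEq.symm (hmod t))
  have hlimI : ∀ t, Tendsto (fun n => eLpNorm (X n t - I t) 2 P) atTop (𝓝 0) := by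
    intro t
    have e : ∀ n, eLpNorm (X n t - I t) 2 P = eLpNorm (X n t - Y t) 2 P := fun n =>
      eLpNorm_congr_ae (by filter_upwards [hmod t] with ω hω; simp [hω])
    simp_rw [e]
    exact hlim t
  have hIM : MemM2 𝓕 P I := by
    refine ⟨martingale_of_tendsto_eLpNorm hX hAd hI2 hlimI, fun ω => ?_, hI2⟩
    by_cases hω : ω ∈ A
    · have e : (fun t => I t ω) = g ω := funext fun t => if_pos hω
      rw [e]
      exact IsCadlag.of_tendstoUniformly (fun k => (hX (φ k)).cadlag ω) (hg ω hω)
    · have e : (fun t => I t ω) = fun _ => 0 := funext fun t => if_neg hω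
      rw [e]
      exact fun t => ⟨continuousWithinAt_const, 0, tendsto_const_nhds⟩
  refine ⟨I, hmod, hIM, ?_⟩
  have hT := ENNReal.Tendsto.const_mul (a := 2) (hlimI ⟨T, zero_le, le_rfl⟩) (Or.inr (by simp))
  rw [mul_zero] at hT
  exact tendsto_of_tendsto_of_tendsto_of_le_of_le tendsto_const_nhds hT (fun _ => zero_le)
    (fun n => ((hX n).sub hIM).normM2_le)

end Limits

/-! ### The dyadic processes in `𝓜²` -/

section DyadicM2

variable {T : ℝ≥0}

theorem IsCadlag.comp_min {E : Type*} [TopologicalSpace E] {f : ℝ≥0 → E} (hf : IsCadlag f)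
    (c : ℝ≥0) : IsCadlag (fun t : Set.Icc (0 : ℝ≥0) T => f (min (t : ℝ≥0) c)) := by
  intro t
  constructor
  · exact ContinuousWithinAt.comp (t := Set.Ici (min (t : ℝ≥0) c)) (hf _).1
      (by fun_prop) fun s (hs : t ≤ s) =>
        Set.mem_Ici.2 (min_le_min (Subtype.coe_le_coe.2 hs) le_rfl)
  · rcases le_or_gt (t : ℝ≥0) c with h | h
    · obtain ⟨l, hl⟩ := (hf t).2
      have hval : Tendsto (fun s : Set.Icc (0 : ℝ≥0) T => (s : ℝ≥0)) (𝓝[<] t) (𝓝[<] (t : ℝ≥0)) :=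
        tendsto_nhdsWithin_iff.2 ⟨continuous_subtype_val.continuousWithinAt,
          eventually_nhdsWithin_of_forall fun s hs => hs⟩
      refine ⟨l, (hl.comp hval).congr' ?_⟩
      refine eventually_nhdsWithin_of_forall fun s hs => ?_
      simp only [Function.comp_apply]
      rw [min_eq_left ((Subtype.coe_le_coe.2 (le_of_lt hs)).trans h)]
    · refine ⟨f c, tendsto_const_nhds.congr' ?_⟩
      have hopen : IsOpen {s : Set.Icc (0 : ℝ≥0) T | c < (s : ℝ≥0)} :=
        isOpen_lt continuous_const continuous_subtype_val
      filter_upwards [mem_nhdsWithin_of_mem_nhds (hopen.mem_nhds h)] with s hs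
      rw [min_eq_right (le_of_lt hs)]

theorem IsCadlag.smul_const {ι E : Type*} [TopologicalSpace ι] [Preorder ι]
    [NormedAddCommGroup E] [NormedSpace ℝ E] {f : ι → ℝ} (hf : IsCadlag f) (c : E) :
    IsCadlag (fun t => f t • c) := fun t =>
  ⟨(hf t).1.smul continuousWithinAt_const, by
    obtain ⟨l, hl⟩ := (hf t).2
    exact ⟨l • c, hl.smul_const c⟩⟩

theorem IsCadlag.sum {ι κ E : Type*} [TopologicalSpace ι] [Preorder ι]
    [NormedAddCommGroup E] (s : Finset κ) {f : κ → ι → E} (hf : ∀ k, IsCadlag (f k)) :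
    IsCadlag (fun t => ∑ k ∈ s, f k t) := fun t =>
  ⟨tendsto_finsetSum _ fun k _ => (hf k t).1, by
    choose l hl using fun k => (hf k t).2
    exact ⟨∑ k ∈ s, l k, tendsto_finsetSum _ fun k _ => hl k⟩⟩

variable {Ω : Type*} {mΩ : MeasurableSpace Ω} {P : Measure Ω} [IsProbabilityMeasure P]
  {H : Type*} [NormedAddCommGroup H] [InnerProductSpace ℝ H] [CompleteSpace H]
  {𝓕 : Filtration ℝ≥0 mΩ} {M : ℝ≥0 → Ω → ℝ} {Φ : Set.Icc (0 : ℝ≥0) T → Lp H 2 P}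

theorem IsLevyMartingale.memM2_dyadicProcess [TopologicalSpace.SeparableSpace H]
    (h𝓕 : UsualConditions 𝓕 P) (hM : IsLevyMartingale 𝓕 P M) (hM2 : MemLp (M 1) 2 P)
    (hΦ : IsCAd 𝓕 Φ) (n : ℕ) : MemM2 𝓕 P (dyadicProcess M Φ n) := by
  have h0 : ∀ t : Set.Icc (0 : ℝ≥0) T,
      IsMartingaleIncrement P (𝓕 0) (𝓕 t) (dyadicProcess M Φ n t) := by
    intro t
    have h := hM.isMartingaleIncrement_dyadicProcess hM2 hΦ n
      (s := ⟨0, le_rfl, zero_le⟩) (t := t) t.2.1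
    exact h.congr_ae (ae_of_all _ fun ω => by simp [dyadicProcess_zero])
  have had : StronglyAdapted (restrictIcc 𝓕 T) (dyadicProcess M Φ n) := fun t =>
    h𝓕.stronglyMeasurable (h0 t).meas
  refine ⟨⟨had, fun s t hst => ?_⟩, fun ω => ?_, fun t => (h0 t).memLp⟩
  · have hs : Integrable (dyadicProcess M Φ n s) P := (h0 s).memLp.integrable one_le_two
    have h := condExp_sub ((h0 t).memLp.integrable one_le_two) hs (restrictIcc 𝓕 T s)
    have hself := condExp_of_stronglyMeasurable ((restrictIcc 𝓕 T).le s) (had s) hs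
    filter_upwards [h, (hM.isMartingaleIncrement_dyadicProcess hM2 hΦ n hst).condExp]
      with ω h1 h2
    rw [hself] at h1
    exact sub_eq_zero.1 (h1.symm.trans h2)
  · exact IsCadlag.sum _ fun i =>
      (((hM.levy.cadlag ω).comp_min _).sub ((hM.levy.cadlag ω).comp_min _)).smul_const _

end DyadicM2

/-! ### The van Gaans integral -/

section Integral

variable {Ω : Type*} {mΩ : MeasurableSpace Ω} {P : Measure Ω} {T : ℝ≥0}
  {H : Type*} [NormedAddCommGroup H] [InnerProductSpace ℝ H]
  {𝓕 : Filtration ℝ≥0 mΩ} {M : ℝ≥0 → Ω → ℝ} {Φ : Set.Icc (0 : ℝ≥0) T → Lp H 2 P}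

theorem exists_isPartition (t : Set.Icc (0 : ℝ≥0) T) {δ : ℝ} (hδ : 0 < δ) :
    ∃ (n : ℕ) (π : Fin (n + 1) → Set.Icc (0 : ℝ≥0) T), IsPartition π t ∧
      ∀ i : Fin n, |((π i.succ : ℝ≥0) : ℝ) - ((π i.castSucc : ℝ≥0) : ℝ)| < δ := by
  rcases eq_or_ne (t : ℝ≥0) 0 with ht | ht
  · exact ⟨0, fun _ => t, ⟨ht, rfl, Subsingleton.strictMono (α := Fin 1) _⟩,
      fun i => i.elim0⟩
  have htpos : 0 < (t : ℝ≥0) := pos_iff_ne_zero.2 ht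
  obtain ⟨n, hn⟩ := exists_nat_gt (((t : ℝ≥0) : ℝ) / δ)
  have hnpos : (0 : ℝ) < n := lt_of_le_of_lt (by positivity) hn
  have hn' : (0 : ℝ≥0) < n := by exact_mod_cast hnpos
  refine ⟨n, fun i => ⟨((i : ℕ) : ℝ≥0) * (t / n), zero_le, ?_⟩, ⟨?_, ?_, ?_⟩, fun i => ?_⟩
  · refine le_trans ?_ t.2.2
    have hi : ((i : ℕ) : ℝ≥0) ≤ n := by exact_mod_cast Nat.lt_succ_iff.1 i.isLt
    calc ((i : ℕ) : ℝ≥0) * (t / n) ≤ n * (t / n) := by gcongr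
      _ = t := mul_div_cancel₀ _ hn'.ne'
  · simp
  · exact Subtype.ext (by simpa using mul_div_cancel₀ (t : ℝ≥0) hn'.ne')
  · intro i j hij
    have hij' : ((i : ℕ) : ℝ≥0) < (j : ℕ) := by exact_mod_cast hij
    exact Subtype.mk_lt_mk.2 (mul_lt_mul_of_pos_right hij' (by positivity))
  · have e : (((i.succ : ℕ) : ℝ) * (((t : ℝ≥0) : ℝ) / n)
        - ((i.castSucc : ℕ) : ℝ) * (((t : ℝ≥0) : ℝ) / n)) = ((t : ℝ≥0) : ℝ) / n := by
      simp only [Fin.val_succ, Fin.val_castSucc]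
      push_cast
      ring
    push_cast
    rw [e, abs_of_nonneg (by positivity), div_lt_iff₀ hnpos]
    rwa [div_lt_iff₀ hδ, mul_comm] at hn

omit [InnerProductSpace ℝ H] in
theorem exists_uniform_modulus (hΦ : Continuous Φ) {ε : ℝ} (hε : 0 < ε) :
    ∃ δ > 0, ∀ u v : Set.Icc (0 : ℝ≥0) T, |((u : ℝ≥0) : ℝ) - ((v : ℝ≥0) : ℝ)| ≤ δ →
      ‖Φ u - Φ v‖ ≤ ε := by
  obtain ⟨δ, hδ, h⟩ := Metric.uniformContinuous_iff.1
    (CompactSpace.uniformContinuous_of_continuous hΦ) ε hε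
  refine ⟨δ / 2, half_pos hδ, fun u v huv => ?_⟩
  rw [← dist_eq_norm]
  refine (h ?_).le
  rw [Subtype.dist_eq, NNReal.dist_eq]
  linarith

theorem exists_two_pow_inv_mul_le (T : ℝ≥0) {δ : ℝ} (hδ : 0 < δ) :
    ∃ N : ℕ, ∀ n ≥ N, (2 ^ n)⁻¹ * (T : ℝ) ≤ δ := by
  have h : Tendsto (fun n : ℕ => ((2 : ℝ) ^ n)⁻¹ * (T : ℝ)) atTop (𝓝 0) := by
    simp_rw [← inv_pow]
    simpa using (tendsto_pow_atTop_nhds_zero_of_lt_one (r := (2 : ℝ)⁻¹) (by norm_num)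
      (by norm_num)).mul_const (T : ℝ)
  exact eventually_atTop.1 (h.eventually_le_const hδ)

variable [CompleteSpace H] [IsProbabilityMeasure P]

/-- The dyadic processes are close to every Riemann sum along a fine partition. -/
theorem IsLevyMartingale.eLpNorm_dyadicProcess_sub_riemannSum_le
    (hM : IsLevyMartingale 𝓕 P M) (hM2 : MemLp (M 1) 2 P) (hΦ : IsCAd 𝓕 Φ) {n : ℕ} {ε δ : ℝ}
    (hε : 0 ≤ ε)
    (hmod : ∀ u v : Set.Icc (0 : ℝ≥0) T, |((u : ℝ≥0) : ℝ) - ((v : ℝ≥0) : ℝ)| ≤ δ →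
      ‖Φ u - Φ v‖ ≤ ε)
    (hn : (2 ^ n)⁻¹ * (T : ℝ) ≤ δ) {t : Set.Icc (0 : ℝ≥0) T} {k : ℕ}
    {π : Fin (k + 1) → Set.Icc (0 : ℝ≥0) T} (hπ : IsPartition π t)
    (hmesh : ∀ i : Fin k, |((π i.succ : ℝ≥0) : ℝ) - ((π i.castSucc : ℝ≥0) : ℝ)| < δ) :
    MemLp (fun ω => dyadicProcess M Φ n t ω - riemannSum M Φ π ω) 2 P ∧
    eLpNorm (fun ω => dyadicProcess M Φ n t ω - riemannSum M Φ π ω) 2 P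
      ≤ ENNReal.ofReal (√(secondMoment P M t) * ε) := by
  set u : ℕ → Set.Icc (0 : ℝ≥0) T := fun i => π ⟨min i k, by omega⟩ with hu
  have huk : u k = t := by
    rw [← hπ.last]
    simp only [hu]
    congr 1
    exact Fin.ext (min_self k)
  have hsucc : ∀ i : Fin k, u (i + 1) = π i.succ := fun i => by
    simp only [hu]
    congr 1
    exact Fin.ext (min_eq_left i.isLt)
  have hcast : ∀ i : Fin k, u i = π i.castSucc := fun i => by
    simp only [hu]
    congr 1
    exact Fin.ext (min_eq_left i.isLt.le)
  have hsum : ∀ ω, riemannSum M Φ π ω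
      = ∑ i ∈ Finset.range k, (M (u (i + 1)) ω - M (u i) ω) • Φ (u i) ω := fun ω => by
    rw [← Fin.sum_univ_eq_sum_range (fun i => (M (u (i + 1)) ω - M (u i) ω) • Φ (u i) ω)]
    simp_rw [hsucc, hcast]
    rfl
  have hδ0 : 0 ≤ δ := le_trans (by positivity) hn
  have hdiff : ∀ i, ((u (i + 1) : ℝ≥0) : ℝ) - ((u i : ℝ≥0) : ℝ) ≤ δ := by
    intro i
    rcases lt_or_ge i k with hi | hi
    · have e1 := hsucc ⟨i, hi⟩
      have e2 := hcast ⟨i, hi⟩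
      simp only at e1 e2
      rw [e1, e2]
      exact (le_abs_self _).trans (hmesh ⟨i, hi⟩).le
    · have e : u (i + 1) = u i := by
        simp only [hu]
        congr 1
        exact Fin.ext (by simp only; omega)
      rw [e]
      simpa using hδ0
  have humono : Monotone u := fun i j hij =>
    hπ.strictMono.monotone (Fin.mk_le_mk.2 (min_le_min hij le_rfl))
  have hu0 : (u 0 : ℝ≥0) = 0 := by
    have e : u 0 = π 0 := by
      simp only [hu]
      congr 1
    rw [e, hπ.first]
  obtain ⟨h1, h2⟩ := hM.integral_norm_sq_dyadicProcess_sub_sum_le hM2 hΦ hmod hn humono hu0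
    hdiff k
  rw [huk] at h1 h2
  simp_rw [hsum]
  refine ⟨h1, ?_⟩
  rw [← ENNReal.pow_le_pow_left_iff two_ne_zero, ← lintegral_enorm_sq_eq_eLpNorm_sq,
    ← ofReal_integral_norm_sq h1, ← ENNReal.ofReal_pow (by positivity), mul_pow,
    Real.sq_sqrt (secondMoment_nonneg _)]
  exact ENNReal.ofReal_le_ofReal h2

/-- At every time, the dyadic processes converge in `L²`. -/
theorem IsLevyMartingale.exists_tendsto_dyadicProcess
    (hM : IsLevyMartingale 𝓕 P M) (hM2 : MemLp (M 1) 2 P) (hΦ : IsCAd 𝓕 Φ)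
    (hmem : ∀ n (t : Set.Icc (0 : ℝ≥0) T), MemLp (dyadicProcess M Φ n t) 2 P)
    (t : Set.Icc (0 : ℝ≥0) T) :
    ∃ Y : Lp H 2 P, Tendsto (fun n => eLpNorm (dyadicProcess M Φ n t - ⇑Y) 2 P) atTop (𝓝 0) := by
  have hcauchy : CauchySeq fun n => (hmem n t).toLp := by
    refine EMetric.cauchySeq_iff.2 fun η hη => ?_
    obtain ⟨r, hr0, hrη⟩ := ENNReal.lt_iff_exists_nnreal_btwn.1 hη
    have hr : 0 < (r : ℝ) := by exact_mod_cast hr0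
    set ε : ℝ := r / (2 * (√(secondMoment P M t) + 1)) with hε
    have hεpos : 0 < ε := by positivity
    obtain ⟨δ, hδ, hmod⟩ := exists_uniform_modulus hΦ.continuous hεpos
    obtain ⟨k, π, hπ, hmesh⟩ := exists_isPartition t hδ
    obtain ⟨N, hN⟩ := exists_two_pow_inv_mul_le T hδ
    refine ⟨N, fun m hm n hn => lt_of_le_of_lt ?_ hrη⟩
    obtain ⟨a1, a2⟩ := hM.eLpNorm_dyadicProcess_sub_riemannSum_le hM2 hΦ hεpos.le hmod (hN m hm)
      hπ hmesh
    obtain ⟨b1, b2⟩ := hM.eLpNorm_dyadicProcess_sub_riemannSum_le hM2 hΦ hεpos.le hmod (hN n hn)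
      hπ hmesh
    rw [Lp.edist_toLp_toLp]
    have e : dyadicProcess M Φ m t - dyadicProcess M Φ n t
        = (fun ω => dyadicProcess M Φ m t ω - riemannSum M Φ π ω)
          - (fun ω => dyadicProcess M Φ n t ω - riemannSum M Φ π ω) := by
      ext ω; simp
    rw [e]
    refine (eLpNorm_sub_le a1.1 b1.1 one_le_two).trans ((add_le_add a2 b2).trans ?_)
    rw [← ENNReal.ofReal_add (by positivity) (by positivity), ← ENNReal.ofReal_coe_nnreal]
    refine ENNReal.ofReal_le_ofReal ?_
    have hs : 0 ≤ √(secondMoment P M t) := Real.sqrt_nonneg _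
    have : 2 * (√(secondMoment P M t) + 1) * ε = r := by
      rw [hε]; field_simp
    linarith
  obtain ⟨Y, hY⟩ := cauchySeq_tendsto_of_complete hcauchy
  refine ⟨Y, ?_⟩
  rw [tendsto_iff_edist_tendsto_0] at hY
  refine hY.congr fun n => ?_
  rw [Lp.edist_def]
  refine eLpNorm_congr_ae ?_
  filter_upwards [(hmem n t).coeFn_toLp] with ω hω
  simp [hω]

/-- The `L²`-limit of the dyadic processes is the van Gaans integral. -/
theorem IsLevyMartingale.isVanGaansIntegral_of_tendsto
    (hM : IsLevyMartingale 𝓕 P M) (hM2 : MemLp (M 1) 2 P) (hΦ : IsCAd 𝓕 Φ)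
    (hmem : ∀ n (t : Set.Icc (0 : ℝ≥0) T), MemLp (dyadicProcess M Φ n t) 2 P)
    {t : Set.Icc (0 : ℝ≥0) T} {Y : Lp H 2 P}
    (hY : Tendsto (fun n => eLpNorm (dyadicProcess M Φ n t - ⇑Y) 2 P) atTop (𝓝 0)) :
    IsVanGaansIntegral M Φ t Y := by
  intro η hη
  set ε : ℝ := √η / (√(secondMoment P M t) + 1) with hε
  have hεpos : 0 < ε := by positivity
  obtain ⟨δ, hδ, hmod⟩ := exists_uniform_modulus hΦ.continuous hεpos
  obtain ⟨N, hN⟩ := exists_two_pow_inv_mul_le T hδ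
  refine ⟨δ, hδ, fun k π hπ hmesh => ?_⟩
  have hbound : ∀ᶠ n in atTop, eLpNorm (fun ω => Y ω - riemannSum M Φ π ω) 2 P
      ≤ eLpNorm (dyadicProcess M Φ n t - ⇑Y) 2 P
        + ENNReal.ofReal (√(secondMoment P M t) * ε) := by
    filter_upwards [eventually_ge_atTop N] with n hn
    obtain ⟨a1, a2⟩ := hM.eLpNorm_dyadicProcess_sub_riemannSum_le hM2 hΦ hεpos.le hmod (hN n hn)
      hπ hmesh
    have e : (fun ω => Y ω - riemannSum M Φ π ω)
        = (⇑Y - dyadicProcess M Φ n t)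
          + (fun ω => dyadicProcess M Φ n t ω - riemannSum M Φ π ω) := by
      ext ω; simp
    rw [e, eLpNorm_sub_comm (dyadicProcess M Φ n t)]
    refine (eLpNorm_add_le ((Lp.memLp Y).sub (hmem n t)).1 a1.1 one_le_two).trans ?_
    gcongr
  have hlim := hY.add_const (ENNReal.ofReal (√(secondMoment P M t) * ε))
  rw [zero_add] at hlim
  have h := ge_of_tendsto hlim hbound
  rw [lintegral_enorm_sq_eq_eLpNorm_sq]
  refine (pow_le_pow_left' h 2).trans_lt ?_
  rw [← ENNReal.ofReal_pow (by positivity)]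
  refine (ENNReal.ofReal_lt_ofReal_iff hη).2 ?_
  have hs : 0 ≤ √(secondMoment P M t) := Real.sqrt_nonneg _
  have h1 : (√(secondMoment P M t) + 1) * ε = √η := by
    rw [hε]; field_simp
  have h2 : √(secondMoment P M t) * ε < √η := by linarith
  calc _ < √η ^ 2 := pow_lt_pow_left₀ h2 (by positivity) two_ne_zero
    _ = η := Real.sq_sqrt hη.le

omit [CompleteSpace H] [IsProbabilityMeasure P] in
/-- The van Gaans integral is unique, since there are arbitrarily fine partitions. -/
theorem IsVanGaansIntegral.unique (hM : IsLevyMartingale 𝓕 P M)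
    {t : Set.Icc (0 : ℝ≥0) T} {Y Z : Lp H 2 P}
    (hY : IsVanGaansIntegral M Φ t Y) (hZ : IsVanGaansIntegral M Φ t Z) : Y = Z := by
  refine edist_le_zero.1 (ENNReal.le_of_forall_pos_le_add fun η hη _ => ?_)
  have hη' : (0 : ℝ) < η := by exact_mod_cast hη
  obtain ⟨δ₁, hδ₁, h₁⟩ := hY ((η / 2) ^ 2) (by positivity)
  obtain ⟨δ₂, hδ₂, h₂⟩ := hZ ((η / 2) ^ 2) (by positivity)
  obtain ⟨k, π, hπ, hmesh⟩ := exists_isPartition t (lt_min hδ₁ hδ₂)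
  have a := h₁ k π hπ fun i => (hmesh i).trans_le (min_le_left _ _)
  have b := h₂ k π hπ fun i => (hmesh i).trans_le (min_le_right _ _)
  rw [lintegral_enorm_sq_eq_eLpNorm_sq, ENNReal.ofReal_pow (by positivity)] at a b
  have a' := (ENNReal.pow_right_strictMono two_ne_zero).lt_iff_lt.1 a
  have b' := (ENNReal.pow_right_strictMono two_ne_zero).lt_iff_lt.1 b
  have hR : AEStronglyMeasurable (riemannSum M Φ π) P := by
    refine Finset.aestronglyMeasurable_fun_sum _ fun i _ => ?_
    exact (((hM.martingale.integrable _).1.sub (hM.martingale.integrable _).1)).smul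
      (Lp.aestronglyMeasurable _)
  have e : (⇑Y - ⇑Z) = (fun ω => Y ω - riemannSum M Φ π ω)
      - (fun ω => Z ω - riemannSum M Φ π ω) := by
    ext ω; simp
  rw [Lp.edist_def, e, zero_add]
  refine (eLpNorm_sub_le ((Lp.aestronglyMeasurable Y).sub hR)
    ((Lp.aestronglyMeasurable Z).sub hR) one_le_two).trans ((add_le_add a'.le b'.le).trans ?_)
  rw [← ENNReal.ofReal_add (by positivity) (by positivity), add_halves,
    ENNReal.ofReal_coe_nnreal]

omit [CompleteSpace H] [IsProbabilityMeasure P] in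
theorem IsVanGaansIntegral.vanGaansIntegral_eq (hM : IsLevyMartingale 𝓕 P M)
    {t : Set.Icc (0 : ℝ≥0) T} {Y : Lp H 2 P}
    (hY : IsVanGaansIntegral M Φ t Y) : vanGaansIntegral M Φ t = Y := by
  have hex : ∃ Y, IsVanGaansIntegral M Φ t Y := ⟨Y, hY⟩
  rw [vanGaansIntegral, dif_pos hex]
  exact IsVanGaansIntegral.unique hM hex.choose_spec hY

end Integral

end VanGaans

theorem mainTheorem9
    {Ω : Type*} {mΩ : MeasurableSpace Ω} (P : Measure Ω) [IsProbabilityMeasure P]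
    (𝓕 : Filtration ℝ≥0 mΩ) (h𝓕 : VanGaans.UsualConditions 𝓕 P)
    {H : Type*} [NormedAddCommGroup H] [InnerProductSpace ℝ H] [CompleteSpace H]
    [TopologicalSpace.SeparableSpace H]
    (M : ℝ≥0 → Ω → ℝ) (hM : VanGaans.IsLevyMartingale 𝓕 P M) (hM2 : MemLp (M 1) 2 P)
    (T : ℝ≥0) (hT : 0 < T)
    (Φ : Set.Icc (0 : ℝ≥0) T → Lp H 2 P) (hΦ : VanGaans.IsCAd 𝓕 Φ) :
    -- the integral is well defined
    (∀ t, ∃! Y : Lp H 2 P, VanGaans.IsVanGaansIntegral M Φ t Y) ∧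
    -- the dyadic Riemann-sum processes belong to `𝓜²` and have finite norm
    (∀ n, VanGaans.MemM2 𝓕 P (VanGaans.dyadicProcess M Φ n) ∧
      VanGaans.normM2 P (VanGaans.dyadicProcess M Φ n) < ∞) ∧
    -- the integral has a modification in `𝓜²`, to which they converge in the norm of `𝓜²`
    ∃ I : Set.Icc (0 : ℝ≥0) T → Ω → H,
      VanGaans.IsModification P I (fun t => VanGaans.vanGaansIntegral M Φ t) ∧
      VanGaans.MemM2 𝓕 P I ∧ VanGaans.normM2 P I < ∞ ∧
      Tendsto (fun n => VanGaans.normM2 P (fun t ω => VanGaans.dyadicProcess M Φ n t ω - I t ω))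
        atTop (𝓝 0) := by
  have hdyad := hM.memM2_dyadicProcess h𝓕 hM2 hΦ
  choose Y hY using hM.exists_tendsto_dyadicProcess hM2 hΦ (fun n t => (hdyad n).memLp t)
  have hYint : ∀ t, VanGaans.IsVanGaansIntegral M Φ t (Y t) := fun t =>
    hM.isVanGaansIntegral_of_tendsto hM2 hΦ (fun n t => (hdyad n).memLp t) (hY t)
  have hYeq : ∀ t, VanGaans.vanGaansIntegral M Φ t = Y t := fun t =>
    (hYint t).vanGaansIntegral_eq hM
  refine ⟨fun t => ⟨Y t, hYint t, fun Z hZ => hZ.unique hM (hYint t)⟩,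
    fun n => ⟨hdyad n, (hdyad n).normM2_lt_top⟩, ?_⟩
  obtain ⟨I, hmod, hI, hconv⟩ := VanGaans.exists_memM2_modification
    (Y := fun t => ⇑(VanGaans.vanGaansIntegral M Φ t)) h𝓕 hdyad (fun t => Lp.memLp _)
    (fun t => by simpa only [hYeq] using hY t)
  exact ⟨I, hmod, hI, hI.normM2_lt_top, hconv⟩
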